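/- **Setting.** Let $p,n,m\ge 0$ be integers and $\mathcal G_1,\dots,\mathcal G_p$ real Hilbert spaces. For $i=1,\dots,n$ let $\mathcal K^A_i\subseteq\{1,\dots,p\}$, $\mathcal H_i=\bigoplus_{k\in\mathcal K^A_i}\mathcal G_k$, let $A_i:\mathcal H_i\rightrightarrows\mathcal H_i$ be maximal monotone, and let $R^A_i y=(y_k)_{k\in\mathcal K^A_i}$ for $y\in\bigoplus_{k=1}^p\mathcal G_k$. For $j=1,\dots,m$ let $\mathcal K^B_j\subseteq\{1,\dots,p\}$, $\mathcal B_j=\bigoplus_{k\in\mathcal K^B_j}\mathcal G_k$, let $B_j:\mathcal B_j\to\mathcal B_j$ be $\beta_j$-cocoercive with $\beta_j>0$, i.e. $\langle x-y,B_jx-B_jy\rangle\ge\beta_j\|B_jx-B_jy\|^2$, and let $R^B_jy=(y_k)_{k\in\mathcal K^B_j}$. All direct sums carry the Hilbert product structure. A *solution* is a $y\in\bigoplus_k\mathcal G_k$ with $$0\in\sum_{i=1}^n (R^A_i)^*A_iR^A_iy+\sum_{j=1}^m (R^B_j)^*B_jR^B_jy .\tag{1}$$ **Parameters.** For each $k$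 let $\mathcal I_k=\{i: k\in\mathcal K_i^A\}$ and $\mathcal J_k=\{j:k\in\mathcal K^B_j\}$ in increasing order, $n_k=|\mathcal I_k|$, $m_k=|\mathcal J_k|$, and assume $n_k\ge2$. Label the rows and columns of the matrices below by the elements of $\mathcal I_k$ and $\mathcal J_k$. For each $k$ let $Z_k,W_k\in\mathbb R^{n_k\times n_k}$ be symmetric positive semidefinite, $M_k\in\mathbb R^{(n_k-1)\times n_k}$, $K_k\in\mathbb R^{m_k\times n_k}$, $Q_k\in\mathbb R^{n_k\times m_k}$ such that, with $U_k=(Q_k^{\top}-K_k)^{\top}\operatorname{diag}(\beta_j)_{j\in\mathcal J_k}^{-1}(Q_k^{\top}-K_k)$: * $Z_k\succeq W_k$, $Z_k\succeq U_k$, $Z_k\mathbf 1=0$, $\ker W_k=\operatorname{span}(\mathbf 1)$, $W_k=M_k^{\top}M_k$, $K_k\mathbf 1=\mathbf 1$, $Q_k^{\top}\mathbf 1=\mathbf 1$; * for each $j\in\mathcal J_k$, the last nonzero entry of row $j$ of $K_k$ has a smaller index than the first nonzero entry of column $j$ of $Q_k$. Put $D_k=\operatorname{diag}(Z_k)$ (the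 diagonal part of $Z_k$), and let $L_k$ be minus the strict lower triangle of $Z_k$. Assume moreover (cutoff conditions) that there are indices $i^*_1,\dots,i^*_m\in\{1,\dots,n\}$ such that for all $j$ and all $k\in\mathcal K^B_j$: $\min\mathcal I_k\le i^*_j<\max\mathcal I_k$; $(K_k)_{ji}\ne0$ implies $i\le i^*_j$; and $(Q_k)_{ij}\neq0$ implies $i>i_j^*$. **Lifted operators.** Let $\boldsymbol{\mathcal H}=\bigoplus_i\mathcal H_i$, $\boldsymbol{\mathcal B}=\bigoplus_j\mathcal B_j$, $\boldsymbol{\mathcal Z}=\bigoplus_k\mathcal G_k^{n_k-1}$, $\mathbf A\mathbf x=\prod_iA_ix_i$, $\mathbf B\mathbf x'=(B_jx'_j)_j$, $R_Ay=(R^A_iy)_i$. Let $P_A:\bigoplus_k\mathcal G_k^{\mathcal I_k}\to\boldsymbol{\mathcal H}$, $(P_A\mathbf y)_i=(\mathbf y_{k,i})_{k\in\mathcal K_i^A}$, and $P_B:\bigoplus_k\mathcal G_k^{\mathcal J_k}\to\boldsymbol{\mathcal B}$, $(P_B\mathbf y)_j=(\mathbf y_{k,j})_{k\in\mathcal K_j^B}$,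 be the regrouping (unitary) maps. With $\mathbf N=\bigoplus_k (N_k\otimes I_{\mathcal G_k})$ for a family of matrices $(N_k)_k$, put $D_A=P_A\mathbf DP_A^*$, $L_A=P_A\mathbf LP_A^*$, $K_A=P_B\mathbf KP_A^*$, $Q_A=P_A\mathbf QP_B^*$, $M_A=\mathbf MP_A^*$. **Algorithm (CABRA).** Let $\alpha\in(0,4)$, and let $\gamma_\nu\in(0,2-\frac\alpha2)$ for $\nu\ge0$ satisfy $\sum_\nu\gamma_\nu(2-\frac\alpha2-\gamma_\nu)=\infty$ (for instance, $\gamma_\nu=\gamma$ constant). From any $\mathbf z^0\in\boldsymbol{\mathcal Z}$ iterate $$\mathbf x^\nu=J_{\alpha D_A^{-1}\mathbf A}\big(D_A^{-1}[-M_A^*\mathbf z^\nu+2L_A\mathbf x^\nu-\alpha Q_A\mathbf BK_A\mathbf x^\nu]\big),\qquad \mathbf z^{\nu+1}=\mathbf z^\nu+\gamma_\nu M_A\mathbf x^\nu,\tag{2}$$ where $J_C=(I+C)^{-1}$. Let $$S(\mathbf z)=\big(D_A-2L_A+\alpha\mathbf A+\alpha Q_A\mathbf BK_A\big)^{-1}(-M_A^*\mathbf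 z),\qquad T_\gamma(\mathbf z)=\mathbf z+\gamma M_AS(\mathbf z).$$ **Theorem.** The operator $S:\boldsymbol{\mathcal Z}\to\boldsymbol{\mathcal H}$ is single-valued and everywhere defined, and for every $\mathbf z^\nu$ the first equation of (2) has exactly one solution, namely $\mathbf x^\nu=S(\mathbf z^\nu)$. If (1) has a solution, then for every sequence generated by (2), $(\mathbf z^\nu)$ converges weakly to a point $\mathbf z^*$ that is a fixed point of $T_\gamma$ for every $\gamma\in(0,2-\frac\alpha2)$, such that $S(\mathbf z^*)=R_Ay^*$ for some solution $y^*$ of (1); and $(\mathbf x^\nu)$ converges weakly to $S(\mathbf z^*)$. -/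

import Mathlib

open Filter Topology

noncomputable section

namespace Cabra

/-! ### Set-valued operators -/

section Operators

variable {E : Type*} [NormedAddCommGroup E] [InnerProductSpace ℝ E]

/-- A set-valued operator `A : E ⇉ E` (given by its values) is monotone. -/
def IsMonotoneOp (A : E → Set E) : Prop :=
  ∀ x y u v : E, u ∈ A x → v ∈ A y → 0 ≤ inner ℝ (x - y) (u - v)

/-- `A` is maximal monotone: it is monotone, and its graph is not properly contained in the graph
of another monotone operator. -/
def IsMaximalMonotone (A : E → Set E) : Prop :=
  IsMonotoneOp A ∧ ∀ A' : E → Set E, IsMonotoneOp A' → (∀ x, A x ⊆ A' x) → A' = A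

/-- The single-valued operator `B` is `β`-cocoercive. -/
def IsCocoercive (β : ℝ) (B : E → E) : Prop :=
  ∀ x y : E, β * ‖B x - B y‖ ^ 2 ≤ inner ℝ (x - y) (B x - B y)

/-- The resolvent `(I + A)⁻¹` as a set-valued operator: the set of all `x` with `u ∈ x + A x`. -/
def resolvent (A : E → Set E) (u : E) : Set E :=
  {x | ∃ w ∈ A x, x + w = u}

/-- Weak convergence of a sequence. -/
def WeakTendsto (u : ℕ → E) (l : E) : Prop :=
  Tendsto (fun ν => toWeakSpace ℝ E (u ν)) atTop (𝓝 (toWeakSpace ℝ E l))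

end Operators

/-! ### Lifting linear maps to `ℓ²` direct sums -/

section Lift

variable {ι κ : Type*} [Fintype ι] [Fintype κ]

/-- The continuous linear map into a finite `ℓ²` direct sum with the given components. -/
def tuple {E : Type*} [NormedAddCommGroup E] [InnerProductSpace ℝ E]
    {F : ι → Type*} [∀ i, NormedAddCommGroup (F i)] [∀ i, InnerProductSpace ℝ (F i)]
    (f : ∀ i, E →L[ℝ] F i) : E →L[ℝ] PiLp 2 F :=
  ((PiLp.continuousLinearEquiv 2 ℝ F).symm : (∀ i, F i) →L[ℝ] PiLp 2 F) ∘L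
    ContinuousLinearMap.pi f

/-- The direct sum of the continuous linear maps `f i`. -/
def directSum {E F : ι → Type*}
    [∀ i, NormedAddCommGroup (E i)] [∀ i, InnerProductSpace ℝ (E i)]
    [∀ i, NormedAddCommGroup (F i)] [∀ i, InnerProductSpace ℝ (F i)]
    (f : ∀ i, E i →L[ℝ] F i) : PiLp 2 E →L[ℝ] PiLp 2 F :=
  tuple fun i => f i ∘L PiLp.proj 2 E i

/-- The Kronecker lift `N ⊗ I : V^κ → V^ι` of a real matrix `N`. -/
def kron (V : Type*) [NormedAddCommGroup V] [InnerProductSpace ℝ V] (N : Matrix ι κ ℝ) :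
    PiLp 2 (fun _ : κ => V) →L[ℝ] PiLp 2 (fun _ : ι => V) :=
  tuple fun a => ∑ b, N a b • PiLp.proj 2 (fun _ : κ => V) b

end Lift

/-! ### Product spaces and coupling

`K : Fin q → Finset (Fin p)` lists, for each of `q` operators, the subvectors it acts on. It is used
once for the maximal monotone operators and once for the cocoercive ones. -/

section Spaces

variable {p q : ℕ}

/-- The (ordered) set of the indices of those operators that act on the `k`-th subvector. -/
abbrev Users (K : Fin q → Finset (Fin p)) (k : Fin p) : Type := {i : Fin q // k ∈ K i}

variable (G : Fin p → Type*) [∀ k, NormedAddCommGroup (G k)] [∀ k, InnerProductSpace ℝ (G k)]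
  (K : Fin q → Finset (Fin p))

/-- The domain `⨁_{k ∈ K i} G k` of the `i`-th operator. -/
abbrev OpSpace (i : Fin q) : Type _ := PiLp 2 fun k : {k // k ∈ K i} => G k

/-- The lifted space `⨁_i ⨁_{k ∈ K i} G k`, grouped by operator. -/
abbrev ByOp : Type _ := PiLp 2 fun i : Fin q => OpSpace G K i

/-- The lifted space `⨁_k (G k)^{Users K k}`, grouped by subvector. A factor without users is the
zero space. -/
abbrev BySub : Type _ := PiLp 2 fun k : Fin p => PiLp 2 fun _ : Users K k => G k

/-- The selection operator `R_i y = (y_k)_{k ∈ K i}`. -/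
def sel (i : Fin q) : PiLp 2 G →L[ℝ] OpSpace G K i :=
  tuple fun k => PiLp.proj 2 G k.1

/-- The lifted selection operator `R y = (R_i y)_i`. -/
def selAll : PiLp 2 G →L[ℝ] ByOp G K :=
  tuple fun i => sel G K i

/-- The permutation operator from the grouping by subvector to the grouping by operator:
`(P y)_i = (y_{k,i})_{k ∈ K i}`. -/
def perm : BySub G K →L[ℝ] ByOp G K :=
  tuple fun i => tuple fun k =>
    PiLp.proj 2 (fun _ : Users K k.1 => G k.1) ⟨i, k.2⟩ ∘L
      PiLp.proj 2 (fun k' : Fin p => PiLp 2 fun _ : Users K k' => G k') k.1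

/-- The space `⨁_k (G k)^{n_k - 1}` of the governing sequence, `n_k` the number of users of `k`. -/
abbrev ZSpace : Type _ :=
  PiLp 2 fun k : Fin p => PiLp 2 fun _ : Fin (Fintype.card (Users K k) - 1) => G k

end Spaces

/-! ### Matrix parameters -/

/-- The diagonal part of a square matrix. -/
def diagPart {ι : Type*} [DecidableEq ι] (Z : Matrix ι ι ℝ) : Matrix ι ι ℝ :=
  Matrix.diagonal fun s => Z s s

/-- The strict lower triangle of a square matrix. -/
def strictLower {ι : Type*} [LinearOrder ι] (Z : Matrix ι ι ℝ) : Matrix ι ι ℝ :=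
  Matrix.of fun r c => if c < r then Z r c else 0

/-- `U = (Qᵀ - K)ᵀ diag(β)⁻¹ (Qᵀ - K)`. -/
def Umat {ι κ : Type*} [Fintype κ] [DecidableEq κ] (β : κ → ℝ) (K : Matrix κ ι ℝ)
    (Q : Matrix ι κ ℝ) : Matrix ι ι ℝ :=
  (Q.transpose - K).transpose * (Matrix.diagonal fun t => (β t)⁻¹) * (Q.transpose - K)

/-- The requirements on one set of matrix parameters. -/
structure MatrixReqs {ι κ μ : Type*} [Fintype ι] [LinearOrder ι] [Fintype κ] [DecidableEq κ]
    [Fintype μ] (β : κ → ℝ) (Z W : Matrix ι ι ℝ) (M : Matrix μ ι ℝ) (K : Matrix κ ι ℝ)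
    (Q : Matrix ι κ ℝ) : Prop where
  Z_psd : Z.PosSemidef
  W_psd : W.PosSemidef
  Z_ge_W : (Z - W).PosSemidef
  Z_ge_U : (Z - Umat β K Q).PosSemidef
  Z_one : Z.mulVec 1 = 0
  ker_W : LinearMap.ker W.mulVecLin = Submodule.span ℝ {1}
  W_eq : W = M.transpose * M
  K_one : K.mulVec 1 = 1
  Q_one : Q.transpose.mulVec 1 = 1
  /-- The last nonzero entry of row `t` of `K` comes before the first nonzero entry of column `t`
  of `Q`. -/
  K_before_Q : ∀ t s s', K t s ≠ 0 → Q s' t ≠ 0 → s < s'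

section Algorithm

variable {p n m : ℕ}

/-- One set of matrices for each subvector `k`. The rows and columns that belong to the operators
acting on subvector `k` are labelled by these operators, in increasing order. -/
structure Params (KA : Fin n → Finset (Fin p)) (KB : Fin m → Finset (Fin p)) where
  Z : ∀ k, Matrix (Users KA k) (Users KA k) ℝ
  W : ∀ k, Matrix (Users KA k) (Users KA k) ℝ
  M : ∀ k, Matrix (Fin (Fintype.card (Users KA k) - 1)) (Users KA k) ℝ
  K : ∀ k, Matrix (Users KB k) (Users KA k) ℝ
  Q : ∀ k, Matrix (Users KA k) (Users KB k) ℝ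

variable {KA : Fin n → Finset (Fin p)} {KB : Fin m → Finset (Fin p)}

/-- The cutoff conditions for the cutoff indices `c j` of the cocoercive operators. -/
structure Cutoff (P : Params KA KB) (c : Fin m → Fin n) : Prop where
  /-- `max_{k ∈ KB j} min {i | k ∈ KA i} ≤ c j`. -/
  first_le : ∀ j, ∀ k ∈ KB j, (Finset.univ.filter fun i => k ∈ KA i).min ≤ (c j : WithTop (Fin n))
  /-- `c j < min_{k ∈ KB j} max {i | k ∈ KA i}`. -/
  lt_last : ∀ j, ∀ k ∈ KB j, (c j : WithBot (Fin n)) < (Finset.univ.filter fun i => k ∈ KA i).max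
  /-- Row `j` of `K k` vanishes after the last operator with index at most `c j`. -/
  K_cut : ∀ k (j : Users KB k) (s : Users KA k), P.K k j s ≠ 0 → s.1 ≤ c j.1
  /-- Column `j` of `Q k` vanishes up to the last operator with index at most `c j`. -/
  Q_cut : ∀ k (j : Users KB k) (s : Users KA k), P.Q k s j ≠ 0 → c j.1 < s.1

variable {G : Fin p → Type*} [∀ k, NormedAddCommGroup (G k)] [∀ k, InnerProductSpace ℝ (G k)]
  [∀ k, CompleteSpace (G k)]

/-- The lifted set-valued operator `𝐀 x = ∏_i A_i x_i`. -/
def liftA (A : ∀ i, OpSpace G KA i → Set (OpSpace G KA i)) (x : ByOp G KA) : Set (ByOp G KA) :=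
  {w | ∀ i, w i ∈ A i (x i)}

/-- The lifted operator `𝐁 x = (B_j x_j)_j`. -/
def liftB (B : ∀ j, OpSpace G KB j → OpSpace G KB j) (x : ByOp G KB) : ByOp G KB :=
  WithLp.toLp 2 fun j => B j (x j)

/-- `y` solves `0 ∈ ∑ i, R_i^* A_i R_i y + ∑ j, R_j^* B_j R_j y`. -/
def IsSolution (A : ∀ i, OpSpace G KA i → Set (OpSpace G KA i))
    (B : ∀ j, OpSpace G KB j → OpSpace G KB j) (y : PiLp 2 G) : Prop :=
  ∃ w : ∀ i, OpSpace G KA i, (∀ i, w i ∈ A i (sel G KA i y)) ∧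
    ∑ i, (sel G KA i).adjoint (w i) + ∑ j, (sel G KB j).adjoint (B j (sel G KB j y)) = 0

variable (G) (P : Params KA KB)

/-- `D_A = P_A D P_A^*` with `D_k = diag(Z_k)`. -/
def DA : ByOp G KA →L[ℝ] ByOp G KA :=
  perm G KA ∘L directSum (fun k => kron (G k) (diagPart (P.Z k))) ∘L (perm G KA).adjoint

/-- `D_A⁻¹ = P_A D⁻¹ P_A^*`. -/
def DAinv : ByOp G KA →L[ℝ] ByOp G KA :=
  perm G KA ∘L directSum (fun k => kron (G k) (diagPart (P.Z k))⁻¹) ∘L (perm G KA).adjoint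

/-- `L_A = P_A L P_A^*` with `L_k = -tri(Z_k)`. -/
def LA : ByOp G KA →L[ℝ] ByOp G KA :=
  perm G KA ∘L directSum (fun k => kron (G k) (-strictLower (P.Z k))) ∘L (perm G KA).adjoint

/-- `M_A = M P_A^*`. -/
def MA : ByOp G KA →L[ℝ] ZSpace G KA :=
  directSum (fun k => kron (G k) (P.M k)) ∘L (perm G KA).adjoint

/-- `K_A = P_B K P_A^*`. -/
def KAop : ByOp G KA →L[ℝ] ByOp G KB :=
  perm G KB ∘L directSum (fun k => kron (G k) (P.K k)) ∘L (perm G KA).adjoint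

/-- `Q_A = P_A Q P_B^*`. -/
def QAop : ByOp G KB →L[ℝ] ByOp G KA :=
  perm G KA ∘L directSum (fun k => kron (G k) (P.Q k)) ∘L (perm G KB).adjoint

variable {G}
variable (A : ∀ i, OpSpace G KA i → Set (OpSpace G KA i))
  (B : ∀ j, OpSpace G KB j → OpSpace G KB j) (α : ℝ)

/-- `x` solves the implicit resolvent step of the algorithm at `z`:
`x = J_{α D_A⁻¹ 𝐀} (D_A⁻¹ [-M_A^* z + 2 L_A x - α Q_A 𝐁 K_A x])`. -/
def IsStep (z : ZSpace G KA) (x : ByOp G KA) : Prop :=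
  x ∈ resolvent (fun x' => (fun w => α • DAinv G P w) '' liftA A x')
    (DAinv G P (-(MA G P).adjoint z + (2 : ℝ) • LA G P x
      - α • QAop G P (liftB B (KAop G P x))))

/-- The set-valued operator `D_A - 2 L_A + α 𝐀 + α Q_A 𝐁 K_A`. -/
def coreOp (x : ByOp G KA) : Set (ByOp G KA) :=
  {v | ∃ w ∈ liftA A x,
    v = DA G P x - (2 : ℝ) • LA G P x + α • w + α • QAop G P (liftB B (KAop G P x))}

/-- `S z = (D_A - 2 L_A + α 𝐀 + α Q_A 𝐁 K_A)⁻¹ (-M_A^* z)`; under the assumptions of the theorem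
the inverse is single-valued with full domain, which is part of the conclusion there. -/
def S (z : ZSpace G KA) : ByOp G KA :=
  Classical.epsilon fun x => -(MA G P).adjoint z ∈ coreOp P A B α x

/-- `T_γ = I + γ M_A S`. -/
def T (γ : ℝ) (z : ZSpace G KA) : ZSpace G KA :=
  z + γ • MA G P (S P A B α z)

end Algorithm

end Cabra

end

/-! Write `C = D_A - 2 L_A + α 𝐀 + α Q_A 𝐁 K_A` for the core operator. The algorithm is the
Krasnoselskii–Mann iteration for the zeros of `F = -M_A S`, and everything rests on the estimate `⟨x
- x', v - v'⟩ ≥ (1 - α/4) ‖M_A (x - x')‖²` for `v ∈ C x`, `v' ∈ C x'` (`coreOp_monotone`). The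
quadratic form of `D_A - 2 L_A` is that of `Z`; cocoercivity makes the forward term cost at most
`α/4` times the form of `U ≼ Z`; the remaining `(1 - α/4) Z` dominates `(1 - α/4) W = (1 - α/4)
MᵀM`. With `v = -M_A^* z` the estimate says that `F` is `(1 - α/4)`-cocoercive, which accounts for
the step range `(0, 2 - α/2)`.

`S` is well defined because the cutoff conditions make `C` block lower triangular: it is inverted by
forward substitution, each diagonal block being solved by Minty's theorem
(`StrictlyCausal.exists_solution`, `IsMaximalMonotone.exists_add_eq`).

Zeros of `F` correspond to solutions because `ker M_A` is the range of `R_A` and the range of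
`M_A^*` is `ker R_A^*`, while `R_A^* C R_A` is `α` times the operator in (1)
(`selAll_adjoint_core`).

Finally `x^ν` is bounded by the triangular structure, and `M_A x^ν → 0` strongly. This lets the
monotonicity inequality for `C` pass to weak limits, and the maximality of `C`
(`mem_coreOp_of_forall`) identifies every weak cluster point of `x^ν` as `S z*`. -/

noncomputable section

namespace Cabra

/-! ### Weak limits along filters; ultrafilters play the role of subsequences. -/

section WeakLimits

variable {E F : Type*} [NormedAddCommGroup E] [InnerProductSpace ℝ E]
  [NormedAddCommGroup F] [InnerProductSpace ℝ F] {ι : Type*} {f : Filter ι}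

/-- Weak convergence along a filter, tested against inner products. -/
def WeakLim (f : Filter ι) (u : ι → E) (l : E) : Prop :=
  ∀ w : E, Tendsto (fun i => inner ℝ w (u i)) f (𝓝 (inner ℝ w l))

theorem weakTendsto_of_weakLim [CompleteSpace E] {u : ℕ → E} {l : E} (h : WeakLim atTop u l) :
    WeakTendsto u l := by
  unfold WeakTendsto
  have hi : IsInducing fun (x : WeakSpace ℝ E) (y : StrongDual ℝ E) =>
      (topDualPairing ℝ E).flip x y := ⟨rfl⟩
  rw [hi.tendsto_nhds_iff, tendsto_pi_nhds]
  intro y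
  have : Tendsto (fun i => y (u i)) atTop (𝓝 (y l)) := by
    simpa using h ((InnerProductSpace.toDual ℝ E).symm y)
  exact this

theorem WeakLim.of_ultrafilter {u : ι → E} {l : E}
    (h : ∀ g : Ultrafilter ι, (g : Filter ι) ≤ f → WeakLim (g : Filter ι) u l) :
    WeakLim f u l := fun w =>
  (tendsto_iff_ultrafilter _ _ _).2 fun g hg => by
    exact h g hg w

theorem WeakLim.unique [f.NeBot] {u : ι → E} {l l' : E} (h : WeakLim f u l)
    (h' : WeakLim f u l') : l = l' :=
  ext_inner_left ℝ fun w => tendsto_nhds_unique (h w) (h' w)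

theorem WeakLim.map [CompleteSpace E] [CompleteSpace F] {u : ι → E} {l : E} (h : WeakLim f u l)
    (T : E →L[ℝ] F) : WeakLim f (fun i => T (u i)) (T l) := fun w => by
  simpa [ContinuousLinearMap.adjoint_inner_left] using h (T.adjoint w)

theorem weakLim_of_tendsto {u : ι → E} {l : E} (h : Tendsto u f (𝓝 l)) : WeakLim f u l :=
  fun _ => tendsto_const_nhds.inner h

/-- A strongly vanishing sequence paired with a bounded one gives a null sequence. -/
theorem tendsto_inner_zero_of_bounded {a b : ι → E} (ha : Tendsto a f (𝓝 0)) {C : ℝ}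
    (hb : ∀ i, ‖b i‖ ≤ C) : Tendsto (fun i => inner ℝ (a i) (b i)) f (𝓝 0) := by
  have h1 : Tendsto (fun i => ‖a i‖ * C) f (𝓝 0) := by
    simpa using ha.norm.mul_const C
  refine squeeze_zero_norm (fun i => ?_) h1
  exact (norm_inner_le_norm _ _).trans (mul_le_mul_of_nonneg_left (hb i) (norm_nonneg _))

/-- Bounded families in a Hilbert space converge weakly along ultrafilters. -/
theorem exists_weakLim [CompleteSpace E] (g : Ultrafilter ι) {u : ι → E} {C : ℝ}
    (hu : ∀ᶠ i in (g : Filter ι), ‖u i‖ ≤ C) : ∃ l : E, WeakLim (g : Filter ι) u l := by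
  have hb : ∀ w : E, ∀ᶠ i in (g : Filter ι), |inner ℝ w (u i)| ≤ ‖w‖ * C := fun w =>
    hu.mono fun i hi => (abs_real_inner_le_norm _ _).trans
      (mul_le_mul_of_nonneg_left hi (norm_nonneg _))
  have hlim : ∀ w : E, ∃ r : ℝ, |r| ≤ ‖w‖ * C ∧
      Tendsto (fun i => inner ℝ w (u i)) (g : Filter ι) (𝓝 r) := by
    intro w
    have hc : IsCompact (Set.Icc (-(‖w‖ * C)) (‖w‖ * C)) := isCompact_Icc
    obtain ⟨r, hr, hle⟩ := hc.ultrafilter_le_nhds (g.map fun i => inner ℝ w (u i)) (by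
      rw [le_principal_iff]
      exact (hb w).mono fun i hi => abs_le.1 hi)
    exact ⟨r, abs_le.2 hr, hle⟩
  choose r hr ht using hlim
  -- The limits are linear in `w` by uniqueness of limits and bounded by `C`, so Riesz
  -- representation supplies the weak limit.
  let ℓ : E →ₗ[ℝ] ℝ :=
    { toFun := r
      map_add' := fun a b => tendsto_nhds_unique (ht (a + b)) (by
        simpa only [inner_add_left] using (ht a).add (ht b))
      map_smul' := fun c a => tendsto_nhds_unique (ht (c • a)) (by
        simpa only [real_inner_smul_left, RingHom.id_apply, smul_eq_mul] using
          (ht a).const_mul c) }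
  let L : StrongDual ℝ E := ℓ.mkContinuous C fun w => by
    rw [mul_comm]
    exact hr w
  refine ⟨(InnerProductSpace.toDual ℝ E).symm L, fun w => ?_⟩
  have : inner ℝ w ((InnerProductSpace.toDual ℝ E).symm L) = r w := by
    rw [real_inner_comm]
    simp [L, ℓ]
  rw [this]
  exact ht w

end WeakLimits

/-! ### The Krasnoselskii–Mann iteration for a cocoercive operator. -/

section KrasnoselskiiMann

variable {E : Type*} [NormedAddCommGroup E] [InnerProductSpace ℝ E]

theorem IsCocoercive.lipschitz {β : ℝ} (hβ : 0 < β) {B : E → E} (hB : IsCocoercive β B) (x y : E) :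
    ‖B x - B y‖ ≤ β⁻¹ * ‖x - y‖ := by
  have h := (hB x y).trans (real_inner_le_norm _ _)
  rcases (norm_nonneg (B x - B y)).eq_or_lt with h0 | h0
  · rw [← h0]
    positivity
  · rw [inv_mul_eq_div, le_div_iff₀ hβ]
    nlinarith

variable {c : ℝ} {F : E → E}

/-- With `d` the change of `F` along the step, cocoercivity reads `c ‖d‖² ≤ -g ⟨F z, d⟩`, hence `2
⟨F z, d⟩ + ‖d‖² ≤ (1 - 2c/g) ‖d‖² ≤ 0`. -/
theorem IsCocoercive.step_norm_le (hF : IsCocoercive c F) {g : ℝ} (hg : g ∈ Set.Ioo 0 (2 * c))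
    (z : E) : ‖F (z - g • F z)‖ ≤ ‖F z‖ := by
  have h := hF (z - g • F z) z
  set d := F (z - g • F z) - F z with hd
  have e : F (z - g • F z) = F z + d := by rw [hd]; abel
  have h1 : inner ℝ (z - g • F z - z) d = -(g * inner ℝ (F z) d) := by
    rw [sub_sub_cancel_left, inner_neg_left, real_inner_smul_left]
  rw [h1] at h
  have h2 : ‖F z + d‖ ^ 2 = ‖F z‖ ^ 2 + 2 * inner ℝ (F z) d + ‖d‖ ^ 2 := norm_add_sq_real _ _
  have h3 : ‖F z + d‖ ^ 2 ≤ ‖F z‖ ^ 2 := by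
    have h4 : g * (2 * inner ℝ (F z) d + ‖d‖ ^ 2) ≤ 0 := by
      nlinarith [hg.2, sq_nonneg ‖d‖]
    have := nonpos_of_mul_nonpos_right h4 hg.1
    linarith
  rw [e]
  exact le_of_sq_le_sq h3 (norm_nonneg _)

theorem IsCocoercive.step_dist_sq_le (hF : IsCocoercive c F) {g : ℝ} (hg : 0 < g) (z : E)
    {z₀ : E} (h₀ : F z₀ = 0) :
    ‖z - g • F z - z₀‖ ^ 2 ≤ ‖z - z₀‖ ^ 2 - g * (2 * c - g) * ‖F z‖ ^ 2 := by
  have h := hF z z₀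
  rw [h₀, sub_zero] at h
  have e : z - g • F z - z₀ = (z - z₀) - g • F z := by abel
  rw [e, norm_sub_sq_real, real_inner_smul_right, norm_smul, mul_pow, Real.norm_eq_abs, sq_abs]
  nlinarith

/-- Krasnoselskii–Mann iteration for the zeros of a cocoercive operator. -/
theorem IsCocoercive.weakLim_iterate [CompleteSpace E] (hF : IsCocoercive c F) (hc : 0 < c)
    {γ : ℕ → ℝ} (hγ : ∀ ν, γ ν ∈ Set.Ioo 0 (2 * c))
    (hsum : Tendsto (fun N => ∑ ν ∈ Finset.range N, γ ν * (2 * c - γ ν)) atTop atTop)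
    {z : ℕ → E} (hz : ∀ ν, z (ν + 1) = z ν - γ ν • F (z ν)) (h₀ : ∃ z₀, F z₀ = 0) :
    (∃ C, ∀ ν, ‖z ν‖ ≤ C) ∧ Tendsto (fun ν => F (z ν)) atTop (𝓝 0) ∧
      ∃ l, F l = 0 ∧ WeakLim atTop z l := by
  have hdec : ∀ z₀, F z₀ = 0 → ∀ ν, ‖z (ν + 1) - z₀‖ ^ 2 ≤
      ‖z ν - z₀‖ ^ 2 - γ ν * (2 * c - γ ν) * ‖F (z ν)‖ ^ 2 := fun z₀ h ν => by
    rw [hz ν]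
    exact hF.step_dist_sq_le (hγ ν).1 _ h
  have hpos : ∀ ν, 0 < γ ν * (2 * c - γ ν) := fun ν =>
    mul_pos (hγ ν).1 (sub_pos.2 (hγ ν).2)
  have hanti : ∀ z₀, F z₀ = 0 → Antitone fun ν => ‖z ν - z₀‖ ^ 2 := fun z₀ h =>
    antitone_nat_of_succ_le fun ν => (hdec z₀ h ν).trans
      (sub_le_self _ (mul_nonneg (hpos ν).le (sq_nonneg _)))
  have hlim : ∀ z₀, F z₀ = 0 → ∃ r, Tendsto (fun ν => ‖z ν - z₀‖ ^ 2) atTop (𝓝 r) :=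
    fun z₀ h => ⟨_, tendsto_atTop_ciInf (hanti z₀ h) ⟨0, by rintro _ ⟨ν, rfl⟩; positivity⟩⟩
  obtain ⟨z₀, hz₀⟩ := h₀
  have hbdd : ∀ ν, ‖z ν‖ ≤ ‖z 0 - z₀‖ + ‖z₀‖ := fun ν => by
    have h1 : ‖z ν - z₀‖ ≤ ‖z 0 - z₀‖ :=
      le_of_sq_le_sq (hanti z₀ hz₀ (Nat.zero_le ν)) (norm_nonneg _)
    calc ‖z ν‖ = ‖(z ν - z₀) + z₀‖ := by rw [sub_add_cancel]
      _ ≤ _ := (norm_add_le _ _).trans (by linarith)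
  have hFanti : Antitone fun ν => ‖F (z ν)‖ := antitone_nat_of_succ_le fun ν => by
    rw [hz ν]
    exact hF.step_norm_le (hγ ν) _
  have hF0 : Tendsto (fun ν => ‖F (z ν)‖) atTop (𝓝 0) := by
    -- Telescoping the Fejér inequality; since residuals decrease, each may be replaced by the last.
    -- Divergence of the sum then forces the residual itself to zero, not merely along a
    -- subsequence.
    have hsumle : ∀ N, (∑ ν ∈ Finset.range N, γ ν * (2 * c - γ ν)) * ‖F (z N)‖ ^ 2 ≤
        ‖z 0 - z₀‖ ^ 2 - ‖z N - z₀‖ ^ 2 := by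
      intro N
      rw [Finset.sum_mul]
      calc _ ≤ ∑ ν ∈ Finset.range N, (‖z ν - z₀‖ ^ 2 - ‖z (ν + 1) - z₀‖ ^ 2) := by
            refine Finset.sum_le_sum fun ν hν => ?_
            have h1 : ‖F (z N)‖ ^ 2 ≤ ‖F (z ν)‖ ^ 2 :=
              pow_le_pow_left₀ (norm_nonneg _) (hFanti (Finset.mem_range.1 hν).le) 2
            have h2 := mul_le_mul_of_nonneg_left h1 (hpos ν).le
            linarith [hdec z₀ hz₀ ν]
        _ = _ := Finset.sum_range_sub' (fun ν => ‖z ν - z₀‖ ^ 2) N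
    have hq : Tendsto (fun N => ‖z 0 - z₀‖ ^ 2 / ∑ ν ∈ Finset.range N, γ ν * (2 * c - γ ν))
        atTop (𝓝 0) := hsum.const_div_atTop _
    have hsq : Tendsto (fun N => ‖F (z N)‖ ^ 2) atTop (𝓝 0) := by
      refine squeeze_zero' (Eventually.of_forall fun N => sq_nonneg _) ?_ hq
      filter_upwards [hsum.eventually_gt_atTop 0] with N hN
      rw [le_div_iff₀ hN, mul_comm]
      exact (hsumle N).trans (sub_le_self _ (sq_nonneg _))
    have := hsq.sqrt
    simpa [Real.sqrt_sq (norm_nonneg _)] using this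
  have hF0' : Tendsto (fun ν => F (z ν)) atTop (𝓝 0) := tendsto_zero_iff_norm_tendsto_zero.2 hF0
  -- Demiclosedness: in `c ‖F (z ν) - F l‖² ≤ ⟨z ν - l, F (z ν) - F l⟩` the right side tends to zero
  -- and the left side to `c ‖F l‖²`.
  have hzero : ∀ (g : Ultrafilter ℕ) (l : E), (g : Filter ℕ) ≤ atTop →
      WeakLim (g : Filter ℕ) z l → F l = 0 := by
    intro g l hg hl
    have h1 : Tendsto (fun ν => inner ℝ (F (z ν)) (z ν - l)) (g : Filter ℕ) (𝓝 0) :=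
      tendsto_inner_zero_of_bounded (hF0'.mono_left hg)
        (C := ‖z 0 - z₀‖ + ‖z₀‖ + ‖l‖) fun ν =>
          (norm_sub_le _ _).trans (by linarith [hbdd ν])
    have h2 : Tendsto (fun ν => inner ℝ (F l) (z ν - l)) (g : Filter ℕ) (𝓝 0) := by
      simpa [inner_sub_right] using (hl (F l)).sub_const (inner ℝ (F l) l)
    have h3 : Tendsto (fun ν => inner ℝ (z ν - l) (F (z ν) - F l)) (g : Filter ℕ) (𝓝 0) := by
      have := h1.sub h2
      rw [sub_zero] at this
      refine this.congr fun ν => ?_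
      rw [← inner_sub_left, real_inner_comm]
    have h4 : Tendsto (fun ν => c * ‖F (z ν) - F l‖ ^ 2) (g : Filter ℕ)
        (𝓝 (c * ‖0 - F l‖ ^ 2)) :=
      (((hF0'.mono_left hg).sub_const _).norm.pow 2).const_mul c
    have h5 := le_of_tendsto_of_tendsto' h4 h3 fun ν => hF (z ν) l
    rw [zero_sub, norm_neg] at h5
    have h6 : ‖F l‖ ^ 2 ≤ 0 := nonpos_of_mul_nonpos_right h5 hc
    simpa using le_antisymm h6 (sq_nonneg _)
  refine ⟨⟨_, hbdd⟩, hF0', ?_⟩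
  let g₀ : Ultrafilter ℕ := Ultrafilter.of atTop
  have hg₀ : (g₀ : Filter ℕ) ≤ atTop := Ultrafilter.of_le _
  obtain ⟨l, hl⟩ := exists_weakLim g₀ (Eventually.of_forall hbdd)
  have hFl := hzero g₀ l hg₀ hl
  refine ⟨l, hFl, WeakLim.of_ultrafilter fun g hg => ?_⟩
  obtain ⟨l', hl'⟩ := exists_weakLim g (Eventually.of_forall hbdd)
  have hFl' := hzero g l' hg hl'
  obtain ⟨r, hr⟩ := hlim l hFl
  obtain ⟨r', hr'⟩ := hlim l' hFl'
  -- Opial's argument: both distances converge along the whole sequence, so by polarization `⟨l -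
  -- l', z ν⟩` does too, and its limits along the two ultrafilters agree.
  have hd : Tendsto (fun ν => inner ℝ (l - l') (z ν)) atTop
      (𝓝 (2⁻¹ * (r' - r + ‖l‖ ^ 2 - ‖l'‖ ^ 2))) := by
    refine ((((hr'.sub hr).add_const (‖l‖ ^ 2)).sub_const (‖l'‖ ^ 2)).const_mul 2⁻¹).congr
      fun ν => ?_
    rw [norm_sub_sq_real, norm_sub_sq_real, inner_sub_left, real_inner_comm l, real_inner_comm l']
    ring
  have e1 := tendsto_nhds_unique (hl (l - l')) (hd.mono_left hg₀)
  have e2 := tendsto_nhds_unique (hl' (l - l')) (hd.mono_left hg)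
  have e3 : l = l' := by
    have : inner ℝ (l - l') (l - l') = (0 : ℝ) := by rw [inner_sub_right, e1, e2, sub_self]
    exact sub_eq_zero.1 (inner_self_eq_zero.1 this)
  rw [e3]
  exact hl'

end KrasnoselskiiMann

/-! ### Minty's theorem by a minimax argument and weak compactness. -/

section Minty

variable {E : Type*} [NormedAddCommGroup E] [InnerProductSpace ℝ E]

/-- The finite case of Minty's theorem, by a minimax argument on the convex hull of the points. -/
theorem exists_inner_le_zero_of_finite {ι : Type*} [Fintype ι] [Nonempty ι] (D : E →L[ℝ] E)
    (hD : ∀ x, 0 ≤ inner ℝ x (D x)) (a u : ι → E)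
    (hmono : ∀ s t, 0 ≤ inner ℝ (a s - a t) (u s - u t)) :
    ∃ x, ∀ s, inner ℝ (x - a s) (D x + u s) ≤ 0 := by
  classical
  let f : E → (ι → ℝ) → ℝ := fun x l => ∑ s, l s * inner ℝ (x - a s) (D x + u s)
  have hXc : IsCompact (convexHull ℝ (Set.range a)) := (Set.finite_range a).isCompact_convexHull ℝ
  have hXn : (convexHull ℝ (Set.range a)).Nonempty := (Set.range_nonempty a).convexHull
  have hconv : ∀ s, ConvexOn ℝ (convexHull ℝ (Set.range a))
      fun x => inner ℝ (x - a s) (D x + u s) := by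
    intro s
    refine ⟨convex_convexHull ℝ _, fun x _ y _ p q hp hq hpq => ?_⟩
    -- The convexity defect of the quadratic is exactly `p q ⟨x - y, D (x - y)⟩`.
    have hxy := mul_nonneg (mul_nonneg hp hq) (hD (x - y))
    obtain rfl : q = 1 - p := by linarith
    simp only [smul_eq_mul, map_add, map_smul, map_sub, inner_add_left, inner_add_right,
      inner_sub_left, inner_sub_right, real_inner_smul_left, real_inner_smul_right] at hxy ⊢
    nlinarith
  obtain ⟨x, -, l, hl, hs⟩ := Sion.exists_isSaddlePointOn (f := f) hXn (convex_convexHull ℝ _) hXc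
    (fun l _ => (show Continuous fun x => f x l by fun_prop).lowerSemicontinuous.lowerSemicontinuousOn _)
    (fun l hl => by
      have : ConvexOn ℝ (convexHull ℝ (Set.range a)) fun x => f x l := by
        simp only [f]
        have hsum : ∀ T : Finset ι, ConvexOn ℝ (convexHull ℝ (Set.range a))
            fun x => ∑ s ∈ T, l s * inner ℝ (x - a s) (D x + u s) := by
          intro T
          induction T using Finset.induction_on with
          | empty => simpa using convexOn_const (0 : ℝ) (convex_convexHull ℝ _)
          | insert s T hs ih =>
            simp only [Finset.sum_insert hs]
            exact ((hconv s).smul (hl.1 s)).add ih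
        exact hsum _
      exact this.quasiconvexOn)
    (convex_stdSimplex ℝ ι) ⟨_, single_mem_stdSimplex ℝ (Classical.arbitrary ι)⟩
    (isCompact_stdSimplex ℝ ι)
    (fun x _ => (show Continuous fun l => f x l by fun_prop).upperSemicontinuous.upperSemicontinuousOn _)
    (fun x _ => by
      have : ConcaveOn ℝ (stdSimplex ℝ ι) fun l => f x l := by
        refine ⟨convex_stdSimplex ℝ ι, fun l _ l' _ p q _ _ _ => le_of_eq ?_⟩
        simp only [f, smul_eq_mul, Pi.add_apply, Pi.smul_apply, Finset.mul_sum]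
        rw [← Finset.sum_add_distrib]
        exact Finset.sum_congr rfl fun s _ => by ring
      exact this.quasiconcaveOn)
  refine ⟨x, fun s => ?_⟩
  -- The saddle inequality is tested at the vertex `s` of the simplex and at the barycentre `b` of
  -- the points with the optimal weights, where the `D` terms cancel.
  have hx := hs (∑ t, l t • a t) ?_ _ (single_mem_stdSimplex ℝ s)
  · have h1 : f x (Pi.single s 1) = inner ℝ (x - a s) (D x + u s) := by
      simp [f, Pi.single_apply]
    rw [h1] at hx
    refine hx.trans ?_
    set b := ∑ t, l t • a t with hb
    have h2 : f b l = ∑ s, l s * inner ℝ (b - a s) (u s) := by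
      have h3 : ∑ s, l s • (b - a s) = 0 := by
        simp only [smul_sub, Finset.sum_sub_distrib, ← Finset.sum_smul, hl.2, one_smul]
        rw [hb, sub_self]
      have h4 : ∑ s, l s * inner ℝ (b - a s) (D b) = 0 := by
        simp only [← real_inner_smul_left, ← sum_inner, h3, inner_zero_left]
      simp only [f, inner_add_right, mul_add, Finset.sum_add_distrib, h4, zero_add]
    have h5 : ∀ s, inner ℝ (b - a s) (u s) = ∑ t, l t * inner ℝ (a t - a s) (u s) := by
      intro s
      have : b - a s = ∑ t, l t • (a t - a s) := by
        simp only [smul_sub, Finset.sum_sub_distrib, ← Finset.sum_smul, hl.2, one_smul, hb]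
      rw [this, sum_inner]
      simp only [real_inner_smul_left]
    rw [h2]
    simp only [h5, Finset.mul_sum]
    -- Symmetrizing in `s` and `t` turns twice the value at the barycentre into `-∑ l_s l_t ⟨a_s -
    -- a_t, u_s - u_t⟩ ≤ 0`.
    have h6 : ∑ s, ∑ t, l s * (l t * inner ℝ (a t - a s) (u s)) =
        ∑ s, ∑ t, l s * (l t * inner ℝ (a s - a t) (u t)) := by
      rw [Finset.sum_comm]
      exact Finset.sum_congr rfl fun s _ => Finset.sum_congr rfl fun t _ => by ring
    have h7 : ∑ s, ∑ t, l s * (l t * inner ℝ (a t - a s) (u s)) +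
        ∑ s, ∑ t, l s * (l t * inner ℝ (a s - a t) (u t)) ≤ 0 := by
      simp only [← Finset.sum_add_distrib]
      refine Finset.sum_nonpos fun s _ => Finset.sum_nonpos fun t _ => ?_
      have h8 := mul_nonneg (mul_nonneg (hl.1 s) (hl.1 t)) (hmono s t)
      simp only [inner_sub_left, inner_sub_right] at h8 ⊢
      nlinarith
    linarith
  · exact (convex_convexHull ℝ _).sum_mem (fun t _ => hl.1 t) hl.2 fun t _ =>
      subset_convexHull ℝ _ ⟨t, rfl⟩

/-- A point that is monotonically related to the graph of a maximal monotone operator belongs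
to it. -/
theorem IsMaximalMonotone.mem_of_forall {A : E → Set E} (hA : IsMaximalMonotone A) {x v : E}
    (h : ∀ a, ∀ u ∈ A a, 0 ≤ inner ℝ (x - a) (v - u)) : v ∈ A x := by
  let A' : E → Set E := fun y => A y ∪ {w | y = x ∧ w = v}
  have hA' : IsMonotoneOp A' := by
    rintro y y' w w' (hw | ⟨rfl, rfl⟩) (hw' | ⟨rfl, rfl⟩)
    · exact hA.1 _ _ _ _ hw hw'
    · have := h y w hw
      rwa [← neg_sub y, ← neg_sub w, inner_neg_neg] at this
    · exact h y' w' hw'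
    · simp
  rw [← hA.2 A' hA' fun y => Set.subset_union_left]
  exact Or.inr ⟨rfl, rfl⟩

/-- Minty's theorem with a coercive linear operator in place of the identity. -/
theorem IsMaximalMonotone.exists_add_eq [CompleteSpace E] {A : E → Set E}
    (hA : IsMaximalMonotone A) (D : E →L[ℝ] E) {d : ℝ} (hd : 0 < d)
    (hD : ∀ x, d * ‖x‖ ^ 2 ≤ inner ℝ x (D x)) {α : ℝ} (hα : 0 < α) (b : E) :
    ∃ x, ∃ w ∈ A x, D x + α • w = b := by
  classical
  -- The equation forces `w = α⁻¹ (b - D x)`; by maximality, `w ∈ A x` amounts to these inequalities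
  -- against the graph.
  suffices h : ∃ x, ∀ a, ∀ u ∈ A a, inner ℝ (x - a) (D x + (α • u - b)) ≤ 0 by
    obtain ⟨x, hx⟩ := h
    refine ⟨x, α⁻¹ • (b - D x), hA.mem_of_forall fun a u hu => ?_, ?_⟩
    · have h1 : α⁻¹ • (b - D x) - u = -(α⁻¹ • (D x + (α • u - b))) := by
        rw [← sub_eq_zero, smul_add, smul_sub, smul_sub, smul_smul, inv_mul_cancel₀ hα.ne', one_smul]
        abel
      rw [h1, inner_neg_right, real_inner_smul_right]
      have := mul_nonpos_of_nonneg_of_nonpos (inv_nonneg.2 hα.le) (hx a u hu)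
      linarith
    · rw [smul_smul, mul_inv_cancel₀ hα.ne', one_smul, add_sub_cancel]
  have hD0 : ∀ x, 0 ≤ inner ℝ x (D x) := fun x => le_trans (by positivity) (hD x)
  rcases isEmpty_or_nonempty {q : E × E // q.2 ∈ A q.1} with hE | ⟨⟨q₀⟩⟩
  · exact ⟨0, fun a u hu => (hE.false ⟨(a, u), hu⟩).elim⟩
  let X := {q : E × E // q.2 ∈ A q.1}
  let v : X → E := fun q => α • q.1.2 - b
  have hfin : ∀ T : Finset X, ∃ x, ∀ q ∈ T, inner ℝ (x - q.1.1) (D x + v q) ≤ 0 := by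
    intro T
    rcases T.eq_empty_or_nonempty with rfl | hT
    · exact ⟨0, by simp⟩
    have : Nonempty T := hT.to_subtype
    obtain ⟨x, hx⟩ := exists_inner_le_zero_of_finite D hD0 (fun q : T => q.1.1.1) (fun q : T => v q.1)
      (fun s t => by
        have h1 := hA.1 s.1.1.1 t.1.1.1 s.1.1.2 t.1.1.2 s.1.2 t.1.2
        have h2 : v s.1 - v t.1 = α • (s.1.1.2 - t.1.1.2) := by
          simp only [v, smul_sub]
          abel
        rw [h2, real_inner_smul_right]
        exact mul_nonneg hα.le h1)
    exact ⟨x, fun q hq => hx ⟨q, hq⟩⟩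
  choose y hy using hfin
  -- Finite subsets of the graph are solved separately; along this ultrafilter every graph point is
  -- eventually included, and a weak limit handles all of them at once.
  let g : Ultrafilter (Finset X) := Ultrafilter.of atTop
  have hg : (g : Filter (Finset X)) ≤ atTop := Ultrafilter.of_le _
  have hev : ∀ q : X, ∀ᶠ T in (g : Filter (Finset X)),
      inner ℝ (y T - q.1.1) (D (y T) + v q) ≤ 0 := fun q =>
    hg <| (eventually_ge_atTop {q}).mono fun T hT => hy T q (hT (Finset.mem_singleton_self q))
  -- One graph point already bounds `y T`, since coercivity makes its inequality quadratic in `‖y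
  -- T‖`.
  have hbd : ∀ᶠ T in (g : Filter (Finset X)),
      ‖y T‖ ≤ (‖D.adjoint q₀.1.1‖ + ‖v q₀‖) / d + ‖q₀.1.1‖ * ‖v q₀‖ / d + 1 := by
    refine (hev q₀).mono fun T hT => ?_
    have h1 := hD (y T)
    have h2 : inner ℝ (q₀.1.1) (D (y T)) ≤ ‖D.adjoint q₀.1.1‖ * ‖y T‖ := by
      rw [← ContinuousLinearMap.adjoint_inner_left]
      exact real_inner_le_norm _ _
    have h3 := (abs_le.1 (abs_real_inner_le_norm (y T) (v q₀))).1
    have h4 := real_inner_le_norm q₀.1.1 (v q₀)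
    simp only [inner_add_right, inner_sub_left] at hT
    have h5 : d * ‖y T‖ ^ 2 ≤
        (‖D.adjoint q₀.1.1‖ + ‖v q₀‖) * ‖y T‖ + ‖q₀.1.1‖ * ‖v q₀‖ := by nlinarith
    rw [← add_div, ← sub_le_iff_le_add, le_div_iff₀ hd]
    by_contra! h6
    set P := ‖D.adjoint q₀.1.1‖ + ‖v q₀‖
    set R := ‖q₀.1.1‖ * ‖v q₀‖
    have hP : 0 ≤ P := by positivity
    have hR : 0 ≤ R := by positivity
    have h7 : 0 < (‖y T‖ - 1) * d := by linarith
    have h8 : 1 < ‖y T‖ := by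
      have := pos_of_mul_pos_left h7 hd.le
      linarith
    nlinarith
  obtain ⟨x, hx⟩ := exists_weakLim g hbd
  refine ⟨x, fun a u hu => ?_⟩
  -- `⟨y, D y⟩` is not weakly continuous. By `0 ≤ ⟨y - x, D (y - x)⟩` it is bounded below by an
  -- affine function of `y`, which is.
  have h1 : Tendsto (fun T => inner ℝ x (D (y T)) + inner ℝ (y T) (D x) - inner ℝ x (D x)
      - inner ℝ a (D (y T)) + inner ℝ (y T - a) (α • u - b)) (g : Filter (Finset X))
      (𝓝 (inner ℝ x (D x) + inner ℝ x (D x) - inner ℝ x (D x)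
      - inner ℝ a (D x) + inner ℝ (x - a) (α • u - b))) := by
    have hDx := hx.map D
    have e1 : Tendsto (fun T => inner ℝ (y T) (D x)) (g : Filter (Finset X))
        (𝓝 (inner ℝ x (D x))) := by
      simpa only [real_inner_comm] using hx (D x)
    have e2 : Tendsto (fun T => inner ℝ (y T - a) (α • u - b)) (g : Filter (Finset X))
        (𝓝 (inner ℝ (x - a) (α • u - b))) := by
      rw [real_inner_comm]
      refine Tendsto.congr (fun T => real_inner_comm (y T - a) (α • u - b)) ?_
      rw [inner_sub_right]
      simp only [inner_sub_right (α • u - b)]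
      exact (hx (α • u - b)).sub_const (inner ℝ (α • u - b) a)
    exact ((((hDx x).add e1).sub_const _).sub (hDx a)).add e2
  have h2 := le_of_tendsto h1 (b := 0) ((hev ⟨(a, u), hu⟩).mono fun T hT => by
    have h3 := hD0 (y T - x)
    simp only [v, map_sub, inner_add_right, inner_sub_left, inner_sub_right] at hT h3 ⊢
    linarith)
  rw [inner_add_right, inner_sub_left]
  linarith

end Minty

/-! ### Inclusions with block lower triangular structure. -/

section Triangular

theorem exists_norm_le_of_forall_apply {ι τ : Type*} [Fintype ι] {E : ι → Type*}
    [∀ i, NormedAddCommGroup (E i)] {x : τ → PiLp 2 E} (h : ∀ i, ∃ C, ∀ ν, ‖x ν i‖ ≤ C) :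
    ∃ C, ∀ ν, ‖x ν‖ ≤ C := by
  choose C hC using h
  refine ⟨√(∑ i, C i ^ 2), fun ν => Real.le_sqrt_of_sq_le ?_⟩
  rw [PiLp.norm_sq_eq_of_L2]
  exact Finset.sum_le_sum fun i _ => pow_le_pow_left₀ (norm_nonneg _) (hC i ν) 2

theorem IsMonotoneOp.mul_norm_sub_le {E : Type*} [NormedAddCommGroup E] [InnerProductSpace ℝ E]
    {A : E → Set E} (hA : IsMonotoneOp A) {D : E →L[ℝ] E} {d : ℝ}
    (hD : ∀ x, d * ‖x‖ ^ 2 ≤ inner ℝ x (D x)) {α : ℝ} (hα : 0 ≤ α) {x x' w w' b b' : E}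
    (hw : w ∈ A x) (hw' : w' ∈ A x') (h : D x + α • w = b) (h' : D x' + α • w' = b') :
    d * ‖x - x'‖ ≤ ‖b - b'‖ := by
  have h1 := mul_nonneg hα (hA _ _ _ _ hw hw')
  have h2 : b - b' = D (x - x') + α • (w - w') := by
    rw [← h, ← h', map_sub, smul_sub]
    abel
  have h3 : d * ‖x - x'‖ ^ 2 ≤ ‖x - x'‖ * ‖b - b'‖ := by
    refine le_trans ?_ (real_inner_le_norm _ _)
    rw [h2, inner_add_right, real_inner_smul_right]
    linarith [hD (x - x')]
  rcases (norm_nonneg (x - x')).eq_or_lt with h0 | h0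
  · rw [← h0, mul_zero]
    exact norm_nonneg _
  · nlinarith

theorem IsMonotoneOp.mul_norm_sub_le' {E : Type*} [NormedAddCommGroup E] [InnerProductSpace ℝ E]
    {A : E → Set E} (hA : IsMonotoneOp A) {D : E →L[ℝ] E} {d : ℝ}
    (hD : ∀ x, d * ‖x‖ ^ 2 ≤ inner ℝ x (D x)) {α : ℝ} (hα : 0 ≤ α) {x x' w w' a a' v v' : E}
    (hw : w ∈ A x) (hw' : w' ∈ A x') (h : D x + α • w + a = v) (h' : D x' + α • w' + a' = v') :
    d * ‖x - x'‖ ≤ ‖v - v'‖ + ‖a - a'‖ := by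
  refine (hA.mul_norm_sub_le hD hα hw hw' (eq_sub_of_add_eq h) (eq_sub_of_add_eq h')).trans ?_
  rw [sub_sub_sub_comm]
  exact norm_sub_le _ _

variable {n : ℕ} {E : Fin n → Type*} [∀ i, NormedAddCommGroup (E i)]

/-- Component `i` of `N x` depends only on the components of `x` before `i`. -/
def StrictlyCausal (N : PiLp 2 E → PiLp 2 E) : Prop :=
  ∀ (x x' : PiLp 2 E) (i : Fin n), (∀ i' < i, x i' = x' i') → N x i = N x' i

variable [∀ i, InnerProductSpace ℝ (E i)]

variable {N : PiLp 2 E → PiLp 2 E} (hN : StrictlyCausal N)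
  {A : ∀ i, E i → Set (E i)} {D : ∀ i, E i →L[ℝ] E i} {d : Fin n → ℝ} (hd : ∀ i, 0 < d i)
  (hD : ∀ i x, d i * ‖x‖ ^ 2 ≤ inner ℝ x (D i x)) {α : ℝ} (hα : 0 < α)

include hN hd hD hα

/-- Forward substitution: once the components before `j` are fixed, `N x j` is a constant and the
`j`-th inclusion is solved by Minty's theorem. Changing component `j` leaves the inclusions already
solved intact. -/
theorem StrictlyCausal.exists_solution [∀ i, CompleteSpace (E i)]
    (hA : ∀ i, IsMaximalMonotone (A i)) (v : PiLp 2 E) :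
    ∃ x w : PiLp 2 E, ∀ i, w i ∈ A i (x i) ∧ D i (x i) + α • w i + N x i = v i := by
  suffices h : ∀ l ≤ n, ∃ x w : PiLp 2 E, ∀ i : Fin n, i.val < l →
      w i ∈ A i (x i) ∧ D i (x i) + α • w i + N x i = v i by
    obtain ⟨x, w, h⟩ := h n le_rfl
    exact ⟨x, w, fun i => h i i.2⟩
  intro l
  induction l with
  | zero => exact fun _ => ⟨0, 0, fun i hi => absurd hi (Nat.not_lt_zero _)⟩
  | succ l ih =>
    intro hl
    obtain ⟨x, w, h⟩ := ih (by omega)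
    let j : Fin n := ⟨l, hl⟩
    obtain ⟨y, u, hu, e⟩ := (hA j).exists_add_eq (D j) (hd j) (hD j) hα (v j - N x j)
    let x' : PiLp 2 E := WithLp.toLp 2 (Function.update x j y)
    let w' : PiLp 2 E := WithLp.toLp 2 (Function.update w j u)
    have hx' : ∀ i, i ≠ j → x' i = x i := fun i hi => Function.update_of_ne hi _ _
    have hw' : ∀ i, i ≠ j → w' i = w i := fun i hi => Function.update_of_ne hi _ _
    have hxj : x' j = y := Function.update_self _ _ _
    have hwj : w' j = u := Function.update_self _ _ _
    refine ⟨x', w', fun i hi => ?_⟩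
    have hNi : N x' i = N x i := hN _ _ _ fun i' hi' => hx' _ fun e => by
      have h1 : i'.val < i.val := hi'
      rw [e] at h1
      have : l < i.val := h1
      omega
    rw [hNi]
    by_cases hij : i = j
    · subst hij
      rw [hxj, hwj, e]
      exact ⟨hu, sub_add_cancel _ _⟩
    · rw [hx' i hij, hw' i hij]
      refine h i (lt_of_le_of_ne (Nat.lt_succ_iff.1 hi) fun e => hij (Fin.ext e))

theorem StrictlyCausal.solution_unique (hA : ∀ i, IsMonotoneOp (A i)) {x x' w w' v : PiLp 2 E}
    (h : ∀ i, w i ∈ A i (x i) ∧ D i (x i) + α • w i + N x i = v i)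
    (h' : ∀ i, w' i ∈ A i (x' i) ∧ D i (x' i) + α • w' i + N x' i = v i) : x = x' := by
  ext i
  induction i using WellFoundedLT.induction with
  | ind i ih =>
    have h1 := (hA i).mul_norm_sub_le' (hD i) hα.le (h i).1 (h' i).1 (h i).2 (h' i).2
    rw [hN x x' i ih] at h1
    simp only [sub_self, norm_zero, add_zero] at h1
    have h2 := nonpos_of_mul_nonpos_right h1 (hd i)
    exact sub_eq_zero.1 (norm_le_zero_iff.1 h2)

theorem StrictlyCausal.exists_bound (hA : ∀ i, IsMonotoneOp (A i)) {K : ℝ}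
    (hK : ∀ x x', ‖N x - N x'‖ ≤ K * ‖x - x'‖) {x w v : ℕ → PiLp 2 E}
    (h : ∀ ν i, w ν i ∈ A i (x ν i) ∧ D i (x ν i) + α • w ν i + N (x ν) i = v ν i)
    {C : ℝ} (hv : ∀ ν, ‖v ν‖ ≤ C) : ∃ C', ∀ ν, ‖x ν‖ ≤ C' := by
  refine exists_norm_le_of_forall_apply fun i => ?_
  induction i using WellFoundedLT.induction with
  | ind i ih =>
    -- Truncation to the components already known to be bounded; `N` cannot see the others at `i`,
    -- so its Lipschitz bound applies. Boundedness then follows by comparison with the solution at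
    -- `ν = 0`.
    let y : ℕ → PiLp 2 E := fun ν => WithLp.toLp 2 fun i' => if i' < i then x ν i' else 0
    have hy : ∀ ν, N (x ν) i = N (y ν) i := fun ν => hN _ _ _ fun i' hi' => by simp [y, hi']
    obtain ⟨R, hR⟩ : ∃ R, ∀ ν, ‖y ν‖ ≤ R := exists_norm_le_of_forall_apply fun i' => by
      by_cases hi' : i' < i
      · simpa [y, hi'] using ih i' hi'
      · exact ⟨0, fun ν => by simp [y, hi']⟩
    refine ⟨(d i)⁻¹ * (2 * C + |K| * (2 * R)) + ‖x 0 i‖, fun ν => ?_⟩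
    have h1 := (hA i).mul_norm_sub_le' (hD i) hα.le (h ν i).1 (h 0 i).1 (h ν i).2 (h 0 i).2
    rw [hy, hy] at h1
    have h2 : ‖v ν i - v 0 i‖ ≤ 2 * C := by
      have := (PiLp.norm_apply_le (v ν - v 0) i).trans (norm_sub_le _ _)
      rw [PiLp.sub_apply] at this
      linarith [hv ν, hv 0]
    have h3 : ‖N (y ν) i - N (y 0) i‖ ≤ |K| * (2 * R) := by
      have h4 := (PiLp.norm_apply_le (N (y ν) - N (y 0)) i).trans (hK _ _)
      rw [PiLp.sub_apply] at h4
      have h5 : ‖y ν - y 0‖ ≤ 2 * R := (norm_sub_le _ _).trans (by linarith [hR ν, hR 0])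
      exact h4.trans (mul_le_mul (le_abs_self K) h5 (norm_nonneg _) (abs_nonneg _))
    have h6 : ‖x ν i - x 0 i‖ ≤ (d i)⁻¹ * (2 * C + |K| * (2 * R)) := by
      rw [inv_mul_eq_div, le_div_iff₀' (hd i)]
      linarith
    calc ‖x ν i‖ = ‖(x ν i - x 0 i) + x 0 i‖ := by rw [sub_add_cancel]
      _ ≤ _ := (norm_add_le _ _).trans (by linarith)

end Triangular

/-! ### Composition and adjoints of lifted matrices. -/

section LiftLemmas

variable {ι κ μ : Type*}

theorem tuple_apply {E : Type*} [NormedAddCommGroup E] [InnerProductSpace ℝ E]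
    {F : ι → Type*} [∀ i, NormedAddCommGroup (F i)] [∀ i, InnerProductSpace ℝ (F i)]
    (f : ∀ i, E →L[ℝ] F i) (x : E) (i : ι) : tuple f x i = f i x := rfl

theorem kron_apply [Fintype κ] (V : Type*) [NormedAddCommGroup V] [InnerProductSpace ℝ V] (N : Matrix ι κ ℝ)
    (x : PiLp 2 fun _ : κ => V) (a : ι) : kron V N x a = ∑ b, N a b • x b := by
  simp [kron, tuple_apply]

variable [Fintype ι]

theorem directSum_apply {E F : ι → Type*}
    [∀ i, NormedAddCommGroup (E i)] [∀ i, InnerProductSpace ℝ (E i)]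
    [∀ i, NormedAddCommGroup (F i)] [∀ i, InnerProductSpace ℝ (F i)]
    (f : ∀ i, E i →L[ℝ] F i) (x : PiLp 2 E) (i : ι) : directSum f x i = f i (x i) := rfl

variable [Fintype κ] [Fintype μ]

omit [Fintype ι] in
theorem kron_comp (V : Type*) [NormedAddCommGroup V] [InnerProductSpace ℝ V]
    (N : Matrix ι κ ℝ) (N' : Matrix κ μ ℝ) : kron V N ∘L kron V N' = kron V (N * N') := by
  ext x a
  simp only [ContinuousLinearMap.comp_apply, kron_apply, Matrix.mul_apply, Finset.sum_smul,
    Finset.smul_sum, smul_smul]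
  exact Finset.sum_comm

theorem kron_adjoint (V : Type*) [NormedAddCommGroup V] [InnerProductSpace ℝ V] [CompleteSpace V]
    (N : Matrix ι κ ℝ) : (kron V N).adjoint = kron V N.transpose := by
  symm
  rw [ContinuousLinearMap.eq_adjoint_iff]
  intro x y
  simp only [PiLp.inner_apply, kron_apply, sum_inner, inner_sum, real_inner_smul_left,
    real_inner_smul_right, Matrix.transpose_apply]
  exact Finset.sum_comm

theorem directSum_comp {E F H : ι → Type*}
    [∀ i, NormedAddCommGroup (E i)] [∀ i, InnerProductSpace ℝ (E i)]
    [∀ i, NormedAddCommGroup (F i)] [∀ i, InnerProductSpace ℝ (F i)]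
    [∀ i, NormedAddCommGroup (H i)] [∀ i, InnerProductSpace ℝ (H i)]
    (f : ∀ i, F i →L[ℝ] H i) (g : ∀ i, E i →L[ℝ] F i) :
    directSum f ∘L directSum g = directSum fun i => f i ∘L g i := rfl

theorem directSum_adjoint {E F : ι → Type*}
    [∀ i, NormedAddCommGroup (E i)] [∀ i, InnerProductSpace ℝ (E i)] [∀ i, CompleteSpace (E i)]
    [∀ i, NormedAddCommGroup (F i)] [∀ i, InnerProductSpace ℝ (F i)] [∀ i, CompleteSpace (F i)]
    (f : ∀ i, E i →L[ℝ] F i) : (directSum f).adjoint = directSum fun i => (f i).adjoint := by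
  symm
  rw [ContinuousLinearMap.eq_adjoint_iff]
  intro x y
  simp only [PiLp.inner_apply, directSum_apply, ContinuousLinearMap.adjoint_inner_left]

end LiftLemmas

/-! ### Regrouping maps, lifted matrix families and selection operators. -/

section Regrouping

variable {p q q' q'' : ℕ}

theorem sum_users_comm {R : Type*} [AddCommMonoid R] (K : Fin q → Finset (Fin p))
    (f : ∀ i k, k ∈ K i → R) :
    ∑ i, ∑ k : {k // k ∈ K i}, f i k.1 k.2 = ∑ k, ∑ s : Users K k, f s.1 k s.2 := by
  rw [← Fintype.sum_sigma', ← Fintype.sum_sigma']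
  exact Fintype.sum_equiv
    ⟨fun t => ⟨t.2.1, t.1, t.2.2⟩, fun t => ⟨t.2.1, t.1, t.2.2⟩, fun _ => rfl, fun _ => rfl⟩
    _ _ fun _ => rfl

variable (G : Fin p → Type*) [∀ k, NormedAddCommGroup (G k)] [∀ k, InnerProductSpace ℝ (G k)]
  [∀ k, CompleteSpace (G k)] (K : Fin q → Finset (Fin p)) {K' : Fin q' → Finset (Fin p)}
  {K'' : Fin q'' → Finset (Fin p)}

omit [∀ k, CompleteSpace (G k)] in
theorem perm_apply (x : BySub G K) (i : Fin q) (k : {k // k ∈ K i}) :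
    perm G K x i k = x k.1 ⟨i, k.2⟩ := rfl

theorem perm_adjoint_apply (x : ByOp G K) (k : Fin p) (s : Users K k) :
    (perm G K).adjoint x k s = x s.1 ⟨k, s.2⟩ := by
  let R : ByOp G K →L[ℝ] BySub G K := tuple fun k => tuple fun s =>
    PiLp.proj 2 (fun k' : {k // k ∈ K s.1} => G k') ⟨k, s.2⟩ ∘L
      PiLp.proj 2 (fun i : Fin q => OpSpace G K i) s.1
  have hR : R = (perm G K).adjoint := by
    rw [ContinuousLinearMap.eq_adjoint_iff]
    intro x y
    simp only [PiLp.inner_apply, perm_apply]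
    exact (sum_users_comm K fun i k h => inner ℝ (x i ⟨k, h⟩) (y k ⟨i, h⟩)).symm
  rw [← hR]
  rfl

theorem perm_adjoint_comp_perm : (perm G K).adjoint ∘L perm G K = .id ℝ _ := by
  ext x k s
  simp only [ContinuousLinearMap.comp_apply, perm_adjoint_apply, perm_apply,
    ContinuousLinearMap.id_apply]

/-- The lift of a family of matrices, conjugated by the regrouping maps. -/
def opMat (N : ∀ k, Matrix (Users K k) (Users K' k) ℝ) : ByOp G K' →L[ℝ] ByOp G K :=
  perm G K ∘L directSum (fun k => kron (G k) (N k)) ∘L (perm G K').adjoint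

variable {K}

theorem opMat_apply (N : ∀ k, Matrix (Users K k) (Users K' k) ℝ) (x : ByOp G K') (i : Fin q)
    (k : {k // k ∈ K i}) : opMat G K N x i k = ∑ s, N k.1 ⟨i, k.2⟩ s • x s.1 ⟨k.1, s.2⟩ := by
  simp only [opMat, ContinuousLinearMap.comp_apply, perm_apply, directSum_apply, kron_apply,
    perm_adjoint_apply]

/-- The inner regrouping maps cancel. As `DA`, `LA`, `KAop` and `QAop` unfold to instances of
`opMat`, matrix identities carry over to operators. -/
theorem opMat_comp (N : ∀ k, Matrix (Users K k) (Users K' k) ℝ)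
    (N' : ∀ k, Matrix (Users K' k) (Users K'' k) ℝ) :
    opMat G K N ∘L opMat G K' N' = opMat G K fun k => N k * N' k := by
  ext x : 1
  have h := fun y => DFunLike.congr_fun (perm_adjoint_comp_perm G K') y
  simp only [ContinuousLinearMap.comp_apply, ContinuousLinearMap.id_apply] at h
  simp only [opMat, ContinuousLinearMap.comp_apply, h, ← kron_comp, ← directSum_comp]

theorem opMat_adjoint (N : ∀ k, Matrix (Users K k) (Users K' k) ℝ) :
    (opMat G K N).adjoint = opMat G K' fun k => (N k).transpose := by
  simp only [opMat, ContinuousLinearMap.adjoint_comp, ContinuousLinearMap.adjoint_adjoint,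
    directSum_adjoint, kron_adjoint]
  rfl

theorem opMat_add (N N' : ∀ k, Matrix (Users K k) (Users K' k) ℝ) (x : ByOp G K') :
    opMat G K (fun k => N k + N' k) x = opMat G K N x + opMat G K N' x := by
  ext i k
  simp only [opMat_apply, PiLp.add_apply, Matrix.add_apply, add_smul, Finset.sum_add_distrib]

theorem opMat_sub (N N' : ∀ k, Matrix (Users K k) (Users K' k) ℝ) (x : ByOp G K') :
    opMat G K (fun k => N k - N' k) x = opMat G K N x - opMat G K N' x := by
  ext i k
  simp only [opMat_apply, PiLp.sub_apply, Matrix.sub_apply, sub_smul, Finset.sum_sub_distrib]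

theorem opMat_diagonal_apply (f : ∀ k, Users K k → ℝ) (x : ByOp G K) (i : Fin q)
    (k : {k // k ∈ K i}) :
    opMat G K (fun k => Matrix.diagonal (f k)) x i k = f k.1 ⟨i, k.2⟩ • x i k := by
  rw [opMat_apply, Finset.sum_eq_single ⟨i, k.2⟩]
  · rw [Matrix.diagonal_apply_eq]
  · intro s _ hs
    rw [Matrix.diagonal_apply_ne' _ hs, zero_smul]
  · simp

theorem opMat_one (x : ByOp G K) : opMat G K (fun k => (1 : Matrix (Users K k) _ ℝ)) x = x := by
  ext i k
  have := opMat_diagonal_apply G (fun k (_ : Users K k) => (1 : ℝ)) x i k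
  simpa only [Matrix.diagonal_one, one_smul] using this

open scoped MatrixOrder in
theorem _root_.Matrix.PosSemidef.exists_eq_transpose_mul_self {ι : Type*} [Fintype ι]
    {N : Matrix ι ι ℝ} (hN : N.PosSemidef) : ∃ R : Matrix ι ι ℝ, N = R.transpose * R := by
  classical
  obtain ⟨R, hR⟩ := CStarAlgebra.nonneg_iff_eq_star_mul_self.mp hN.nonneg
  exact ⟨R, by rw [hR, Matrix.star_eq_conjTranspose, Matrix.conjTranspose_eq_transpose_of_trivial]⟩

theorem inner_opMat_self_nonneg {N : ∀ k, Matrix (Users K k) (Users K k) ℝ}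
    (hN : ∀ k, (N k).PosSemidef) (x : ByOp G K) : 0 ≤ inner ℝ x (opMat G K N x) := by
  choose R hR using fun k => (hN k).exists_eq_transpose_mul_self
  rw [funext hR, ← opMat_comp, ← opMat_adjoint, ContinuousLinearMap.comp_apply,
    ContinuousLinearMap.adjoint_inner_right]
  exact real_inner_self_nonneg

/-! ### Selection -/

omit [∀ k, CompleteSpace (G k)] in
theorem selAll_apply (y : PiLp 2 G) (i : Fin q) (k : {k // k ∈ K i}) :
    selAll G K y i k = y k.1 := rfl

theorem selAll_adjoint_apply (v : ByOp G K) (k : Fin p) :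
    (selAll G K).adjoint v k = ∑ s : Users K k, v s.1 ⟨k, s.2⟩ := by
  let R : ByOp G K →L[ℝ] PiLp 2 G := tuple fun k => ∑ s : Users K k,
    PiLp.proj 2 (fun k' : {k // k ∈ K s.1} => G k') ⟨k, s.2⟩ ∘L
      PiLp.proj 2 (fun i : Fin q => OpSpace G K i) s.1
  have h : ∀ x k, R x k = ∑ s : Users K k, x s.1 ⟨k, s.2⟩ := fun x k => by
    simp [R, tuple_apply]
  have hR : R = (selAll G K).adjoint := by
    rw [ContinuousLinearMap.eq_adjoint_iff]
    intro x y
    simp only [PiLp.inner_apply, h, selAll_apply, sum_inner]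
    exact (sum_users_comm K fun i k h => inner ℝ (x i ⟨k, h⟩) (y k)).symm
  rw [← hR, h]

theorem selAll_adjoint_eq_sum (v : ByOp G K) :
    (selAll G K).adjoint v = ∑ i, (sel G K i).adjoint (v i) := by
  refine ext_inner_right ℝ fun y => ?_
  simp only [sum_inner, ContinuousLinearMap.adjoint_inner_left, PiLp.inner_apply (𝕜 := ℝ) v]
  rfl

theorem opMat_selAll_apply (N : ∀ k, Matrix (Users K k) (Users K' k) ℝ) (y : PiLp 2 G) (i : Fin q)
    (k : {k // k ∈ K i}) :
    opMat G K N (selAll G K' y) i k = (N k.1).mulVec 1 ⟨i, k.2⟩ • y k.1 := by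
  simp only [opMat_apply, selAll_apply, ← Finset.sum_smul, Matrix.mulVec, dotProduct,
    Pi.one_apply, mul_one]

theorem opMat_selAll {N : ∀ k, Matrix (Users K k) (Users K' k) ℝ}
    (hN : ∀ k, (N k).mulVec 1 = 1) (y : PiLp 2 G) :
    opMat G K N (selAll G K' y) = selAll G K y := by
  ext i k
  rw [opMat_selAll_apply, hN, Pi.one_apply, one_smul, selAll_apply]

theorem selAll_adjoint_opMat_selAll {N : ∀ k, Matrix (Users K k) (Users K' k) ℝ}
    (hN : ∀ k, ∑ s, (N k).mulVec 1 s = 0) (y : PiLp 2 G) :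
    (selAll G K).adjoint (opMat G K N (selAll G K' y)) = 0 := by
  ext k
  simp only [selAll_adjoint_apply, opMat_selAll_apply, ← Finset.sum_smul, hN, zero_smul,
    PiLp.zero_apply]

/-- Averaging over the users of each subvector lands in the range of `selAll`; this is how consensus
vectors are recognized below. -/
theorem opMat_average (x : ByOp G K) :
    opMat G K (fun k => (Fintype.card (Users K k) : ℝ)⁻¹ • Matrix.of fun _ _ => 1) x =
      selAll G K (WithLp.toLp 2 fun k =>
        (Fintype.card (Users K k) : ℝ)⁻¹ • (selAll G K).adjoint x k) := by
  ext i k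
  simp only [opMat_apply, selAll_apply, selAll_adjoint_apply, Finset.smul_sum, Matrix.smul_apply,
    Matrix.of_apply, smul_eq_mul, mul_one]

end Regrouping

/-! ### Consequences of the matrix requirements. -/

namespace MatrixReqs

variable {ι κ μ : Type*} [Fintype ι] [LinearOrder ι] [Fintype κ] [DecidableEq κ] [Fintype μ]
  {β : κ → ℝ} {Z W : Matrix ι ι ℝ} {M : Matrix μ ι ℝ} {K : Matrix κ ι ℝ} {Q : Matrix ι κ ℝ}
  (h : MatrixReqs β Z W M K Q)

include h

theorem W_mulVec_one : W.mulVec 1 = 0 := by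
  have : (1 : ι → ℝ) ∈ LinearMap.ker W.mulVecLin := by
    rw [h.ker_W]
    exact Submodule.mem_span_singleton_self 1
  simpa using this

theorem exists_smul_one {x : ι → ℝ} (hx : M.mulVec x = 0) : ∃ r : ℝ, x = r • 1 := by
  have : x ∈ LinearMap.ker W.mulVecLin := by
    rw [LinearMap.mem_ker, Matrix.mulVecLin_apply, h.W_eq, ← Matrix.mulVec_mulVec, hx,
      Matrix.mulVec_zero]
  rw [h.ker_W, Submodule.mem_span_singleton] at this
  obtain ⟨r, hr⟩ := this
  exact ⟨r, hr.symm⟩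

theorem M_mulVec_one : M.mulVec 1 = 0 := by
  have h1 : M.transpose.mulVec (M.mulVec 1) = 0 := by
    rw [Matrix.mulVec_mulVec, ← h.W_eq, h.W_mulVec_one]
  have h2 : M.mulVec 1 ⬝ᵥ M.mulVec 1 = 0 := by
    rw [Matrix.dotProduct_mulVec, ← Matrix.mulVec_transpose, h1, zero_dotProduct]
  exact dotProduct_self_eq_zero.1 h2

/-- `Z s s ≥ W s s = ‖M e_s‖²`, and `M e_s = 0` would make the basis vector `e_s` a multiple of `1`,
impossible with two or more indices. -/
theorem Z_diag_pos (hcard : 2 ≤ Fintype.card ι) (s : ι) : 0 < Z s s := by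
  have h1 : 0 ≤ Z s s - W s s := h.Z_ge_W.diag_nonneg
  have h2 : W s s = ∑ a, M a s * M a s := by
    rw [h.W_eq, Matrix.mul_apply]
    rfl
  have h3 : 0 ≤ W s s := h.W_psd.diag_nonneg
  refine lt_of_lt_of_le (lt_of_le_of_ne h3 fun h4 => ?_) (sub_nonneg.1 h1)
  rw [h2, eq_comm, Finset.sum_eq_zero_iff_of_nonneg fun a _ => mul_self_nonneg _] at h4
  obtain ⟨r, hr⟩ := h.exists_smul_one (x := Pi.single s 1) (by
    ext a
    simpa using h4 a (Finset.mem_univ a))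
  have : Nontrivial ι := Fintype.one_lt_card_iff_nontrivial.1 hcard
  obtain ⟨t, ht⟩ := exists_ne s
  have e1 := congrFun hr s
  have e2 := congrFun hr t
  simp [ht] at e1 e2
  rw [← e2] at e1
  exact one_ne_zero e1

/-- A right inverse of `Mᵀ` modulo the averaging matrix. -/
theorem exists_transpose_mul_eq [Nonempty ι] : ∃ C : Matrix μ ι ℝ,
    M.transpose * C = 1 - (Fintype.card ι : ℝ)⁻¹ • Matrix.of fun _ _ => 1 := by
  set J : Matrix ι ι ℝ := Matrix.of fun _ _ => 1 with hJ
  have hn : (Fintype.card ι : ℝ) ≠ 0 := Nat.cast_ne_zero.2 Fintype.card_ne_zero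
  have hJv : ∀ x : ι → ℝ, J.mulVec x = (∑ s, x s) • 1 := fun x => by
    ext s
    simp [hJ, Matrix.mulVec, dotProduct]
  -- `W + J` is positive definite, as `W` vanishes only on the constants and `J` does not vanish
  -- there. Since `J W = 0` and `J² = n J`, `J (W + J)⁻¹ = J / n`, so `C = M (W + J)⁻¹` works.
  have hdet : IsUnit (W + J).det := by
    rw [isUnit_iff_ne_zero]
    intro h0
    obtain ⟨x, hx0, hx⟩ := Matrix.exists_mulVec_eq_zero_iff.2 h0
    apply hx0
    have h1 : x ⬝ᵥ (W + J).mulVec x = M.mulVec x ⬝ᵥ M.mulVec x + (∑ s, x s) ^ 2 := by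
      rw [Matrix.add_mulVec, dotProduct_add, hJv, dotProduct_smul, dotProduct_one, h.W_eq,
        ← Matrix.mulVec_mulVec, Matrix.dotProduct_mulVec, Matrix.vecMul_transpose, smul_eq_mul, sq]
    rw [hx, dotProduct_zero] at h1
    have h2 : 0 ≤ M.mulVec x ⬝ᵥ M.mulVec x := Finset.sum_nonneg fun a _ => mul_self_nonneg _
    have h3 := sq_nonneg (∑ s, x s)
    obtain ⟨r, rfl⟩ := h.exists_smul_one (dotProduct_self_eq_zero.1 (by linarith))
    have h4 : ∑ s, (r • (1 : ι → ℝ)) s = 0 := pow_eq_zero_iff two_ne_zero |>.1 (by linarith)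
    simp only [Pi.smul_apply, Pi.one_apply, smul_eq_mul, mul_one, Finset.sum_const,
      Finset.card_univ, nsmul_eq_mul] at h4
    rw [(mul_eq_zero.1 h4).resolve_left hn, zero_smul]
  have hWt : W.transpose = W := by rw [h.W_eq, Matrix.transpose_mul, Matrix.transpose_transpose]
  have hJW : J * W = 0 := by
    ext s t
    have h1 := congrFun h.W_mulVec_one t
    rw [← hWt] at h1
    simpa [hJ, Matrix.mul_apply, Matrix.mulVec, dotProduct] using h1
  have hJJ : J * J = (Fintype.card ι : ℝ) • J := by
    ext s t
    simp [hJ, Matrix.mul_apply]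
  have hJN : J * (W + J)⁻¹ = (Fintype.card ι : ℝ)⁻¹ • J := by
    have h1 : J * (W + J) = (Fintype.card ι : ℝ) • J := by rw [mul_add, hJW, hJJ, zero_add]
    have h2 : J = (Fintype.card ι : ℝ) • (J * (W + J)⁻¹) := by
      rw [← Matrix.smul_mul, ← h1, Matrix.mul_assoc, Matrix.mul_nonsing_inv _ hdet, Matrix.mul_one]
    rw [eq_inv_smul_iff₀ hn]
    exact h2.symm
  refine ⟨M * (W + J)⁻¹, ?_⟩
  rw [← Matrix.mul_assoc, ← h.W_eq, ← hJN, eq_sub_iff_add_eq, ← add_mul,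
    Matrix.mul_nonsing_inv _ hdet]

theorem eq_diagPart_add : Z = diagPart Z + strictLower Z + (strictLower Z).transpose := by
  ext s t
  have hs : Z t s = Z s t := by simpa using h.Z_psd.1.apply s t
  simp only [diagPart, strictLower, Matrix.add_apply, Matrix.transpose_apply, Matrix.of_apply,
    Matrix.diagonal_apply]
  rcases lt_trichotomy s t with hlt | rfl | hlt
  · simp [hlt, hlt.ne, hlt.not_gt, hs]
  · simp
  · simp [hlt, hlt.ne', hlt.not_gt]

/-- A triangle and its transpose have the same total, so the entries of `D - 2L` sum to the same
value as those of `Z`, which is zero. -/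
theorem sum_core_mulVec_one :
    ∑ s, (diagPart Z - (2 : ℝ) • (-strictLower Z)).mulVec 1 s = 0 := by
  have h1 : ∑ s, (strictLower Z).transpose.mulVec 1 s = ∑ s, (strictLower Z).mulVec 1 s := by
    simp only [Matrix.mulVec, dotProduct, Pi.one_apply, mul_one, Matrix.transpose_apply]
    exact Finset.sum_comm
  have h2 : ∑ s, Z.mulVec 1 s = 0 := by simp [h.Z_one]
  rw [h.eq_diagPart_add] at h2
  simp only [Matrix.add_mulVec, Pi.add_apply, Finset.sum_add_distrib, h1] at h2
  simp only [smul_neg, sub_neg_eq_add, Matrix.add_mulVec, Matrix.smul_mulVec, Pi.add_apply,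
    Pi.smul_apply, Finset.sum_add_distrib, smul_eq_mul, ← Finset.mul_sum]
  linarith

end MatrixReqs

/-! ### Kernel and range of `M_A`, and monotonicity of the core operator. -/

section CoreOperator

variable {p n m : ℕ} {G : Fin p → Type*} [∀ k, NormedAddCommGroup (G k)]
  [∀ k, InnerProductSpace ℝ (G k)] [∀ k, CompleteSpace (G k)]
  {KA : Fin n → Finset (Fin p)} {KB : Fin m → Finset (Fin p)}

/-! ### The map `M_A` -/

variable {P : Params KA KB}

theorem MA_adjoint_apply (z : ZSpace G KA) :
    (MA G P).adjoint z = perm G KA (directSum (fun k => kron (G k) (P.M k).transpose) z) := by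
  simp only [MA, ContinuousLinearMap.adjoint_comp, ContinuousLinearMap.adjoint_adjoint,
    directSum_adjoint, kron_adjoint]
  rfl

theorem perm_kron_MA (C : ∀ k, Matrix (Users KA k) (Fin (Fintype.card (Users KA k) - 1)) ℝ)
    (x : ByOp G KA) :
    perm G KA (directSum (fun k => kron (G k) (C k)) (MA G P x)) =
      opMat G KA (fun k => C k * P.M k) x := by
  simp only [opMat, ← kron_comp, ← directSum_comp, MA, ContinuousLinearMap.comp_apply]

theorem MA_adjoint_kron (C : ∀ k, Matrix (Fin (Fintype.card (Users KA k) - 1)) (Users KA k) ℝ)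
    (x : ByOp G KA) :
    (MA G P).adjoint (directSum (fun k => kron (G k) (C k)) ((perm G KA).adjoint x)) =
      opMat G KA (fun k => (P.M k).transpose * C k) x := by
  rw [MA_adjoint_apply]
  simp only [opMat, ← kron_comp, ← directSum_comp, ContinuousLinearMap.comp_apply]

theorem norm_MA_sq (x : ByOp G KA) :
    ‖MA G P x‖ ^ 2 = inner ℝ x (opMat G KA (fun k => (P.M k).transpose * P.M k) x) := by
  rw [← perm_kron_MA, ← MA_adjoint_apply, ContinuousLinearMap.adjoint_inner_right,
    real_inner_self_eq_norm_sq]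

variable {β : Fin m → ℝ}
  (hP : ∀ k, MatrixReqs (fun j : Users KB k => β j.1) (P.Z k) (P.W k) (P.M k) (P.K k) (P.Q k))

include hP

theorem MA_selAll (y : PiLp 2 G) : MA G P (selAll G KA y) = 0 := by
  ext k a
  simp only [MA, ContinuousLinearMap.comp_apply, directSum_apply, kron_apply, perm_adjoint_apply,
    selAll_apply, ← Finset.sum_smul]
  have h1 : ∑ s, P.M k a s = (P.M k).mulVec 1 a := by
    simp [Matrix.mulVec, dotProduct]
  rw [h1, (hP k).M_mulVec_one, Pi.zero_apply, zero_smul]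
  rfl

/-- Transposing `MᵀC = 1 - J/n` gives a left inverse of `M` modulo averaging, so a vector in the
kernel equals its own average. -/
theorem exists_eq_selAll [∀ k, Nonempty (Users KA k)] {x : ByOp G KA} (hx : MA G P x = 0) :
    ∃ y, x = selAll G KA y := by
  choose C hC using fun k => (hP k).exists_transpose_mul_eq
  have h1 : ∀ k, (C k).transpose * P.M k =
      1 - (Fintype.card (Users KA k) : ℝ)⁻¹ • Matrix.of fun _ _ => 1 := fun k => by
    have := congrArg Matrix.transpose (hC k)
    rw [Matrix.transpose_mul, Matrix.transpose_transpose, Matrix.transpose_sub,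
      Matrix.transpose_one, Matrix.transpose_smul] at this
    exact this
  have h2 := perm_kron_MA (P := P) (fun k => (C k).transpose) x
  rw [hx, map_zero, map_zero, funext h1, opMat_sub, opMat_one, opMat_average, eq_comm,
    sub_eq_zero] at h2
  exact ⟨_, h2⟩

/-- The preimage is the lift of `C` applied to `v`: the averaging error in `MᵀC = 1 - J/n` vanishes
because `R_A^* v = 0`. -/
theorem exists_MA_adjoint_eq [∀ k, Nonempty (Users KA k)] {v : ByOp G KA}
    (hv : (selAll G KA).adjoint v = 0) : ∃ z, (MA G P).adjoint z = v := by
  choose C hC using fun k => (hP k).exists_transpose_mul_eq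
  have h1 : ∀ k, (P.M k).transpose * C k =
      1 - (Fintype.card (Users KA k) : ℝ)⁻¹ • Matrix.of fun _ _ => 1 := fun k => by
    convert hC k
  refine ⟨_, (MA_adjoint_kron C v).trans ?_⟩
  rw [funext h1, opMat_sub, opMat_one, opMat_average, hv, sub_eq_self]
  ext i k
  simp [selAll_apply]

/-! ### Monotonicity -/

/-- `D - 2L` and the symmetric matrix `Z` have the same symmetric part. -/
theorem inner_DA_sub_LA (x : ByOp G KA) :
    inner ℝ x (DA G P x - (2 : ℝ) • LA G P x) = inner ℝ x (opMat G KA P.Z x) := by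
  have h0 : P.Z = fun k => diagPart (P.Z k) + strictLower (P.Z k) + (strictLower (P.Z k)).transpose :=
    funext fun k => (hP k).eq_diagPart_add
  have h1 : inner ℝ x (opMat G KA (fun k => (strictLower (P.Z k)).transpose) x) =
      inner ℝ x (opMat G KA (fun k => strictLower (P.Z k)) x) := by
    rw [← opMat_adjoint, ContinuousLinearMap.adjoint_inner_right, real_inner_comm]
  have h2 : LA G P x = -opMat G KA (fun k => strictLower (P.Z k)) x := by
    have h3 := opMat_sub G (fun k => (0 : Matrix (Users KA k) (Users KA k) ℝ))
      (fun k => strictLower (P.Z k)) x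
    have h4 : opMat G KA (fun k => (0 : Matrix (Users KA k) (Users KA k) ℝ)) x = 0 := by
      ext i k
      simp [opMat_apply]
    rw [h4, zero_sub] at h3
    simp only [zero_sub] at h3
    exact h3
  have h5 : inner ℝ x (opMat G KA P.Z x) = inner ℝ x (opMat G KA (fun k =>
      diagPart (P.Z k) + strictLower (P.Z k) + (strictLower (P.Z k)).transpose) x) := by
    rw [← h0]
  rw [h5, h2, opMat_add, opMat_add, inner_add_right, inner_add_right, h1, smul_neg,
    sub_neg_eq_add, inner_add_right, real_inner_smul_right]
  have h6 : inner ℝ x (DA G P x) = inner ℝ x (opMat G KA (fun k => diagPart (P.Z k)) x) := rfl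
  rw [h6]
  ring

omit hP in
theorem inner_opMat_Umat (x : ByOp G KA) :
    inner ℝ x (opMat G KA (fun k => Umat (fun j : Users KB k => β j.1) (P.K k) (P.Q k)) x) =
      ∑ j, (β j)⁻¹ * ‖opMat G KB (fun k => (P.Q k).transpose - P.K k) x j‖ ^ 2 := by
  simp only [Umat]
  rw [← opMat_comp, ← opMat_comp, ← opMat_adjoint, ContinuousLinearMap.comp_apply,
    ContinuousLinearMap.comp_apply, ContinuousLinearMap.adjoint_inner_right, PiLp.inner_apply]
  refine Finset.sum_congr rfl fun j _ => ?_
  set y := opMat G KB (fun k => (P.Q k).transpose - P.K k) x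
  have : opMat G KB (fun k => Matrix.diagonal fun t : Users KB k => (β t.1)⁻¹) y j =
      (β j)⁻¹ • y j := by
    ext k
    rw [opMat_diagonal_apply, PiLp.smul_apply]
  rw [this, real_inner_smul_right, real_inner_self_eq_norm_sq]

variable {A : ∀ i, OpSpace G KA i → Set (OpSpace G KA i)}
  {B : ∀ j, OpSpace G KB j → OpSpace G KB j}
  (hβ : ∀ j, 0 < β j) (hB : ∀ j, IsCocoercive (β j) (B j))

-- Split `Q_A^* = K_A + (Q_A^* - K_A)`. Cocoercivity controls the first part by `β_j ‖b_j‖²`, and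
-- completing the square against the second loses `‖V_j‖² / (4 β_j)`, which sums to a quarter of the
-- form of `U`.
omit hP in
include hβ hB in
theorem inner_forward_ge (x x' : ByOp G KA) :
    -(4⁻¹ * inner ℝ (x - x') (opMat G KA
      (fun k => Umat (fun j : Users KB k => β j.1) (P.K k) (P.Q k)) (x - x'))) ≤
      inner ℝ (x - x') (QAop G P (liftB B (KAop G P x)) - QAop G P (liftB B (KAop G P x'))) := by
  set b := liftB B (KAop G P x) - liftB B (KAop G P x') with hb
  set V := opMat G KB (fun k => (P.Q k).transpose - P.K k) (x - x') with hV
  have h1 : inner ℝ (x - x') (QAop G P (liftB B (KAop G P x)) - QAop G P (liftB B (KAop G P x'))) =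
      inner ℝ (KAop G P (x - x')) b + inner ℝ V b := by
    have h2 : (QAop G P).adjoint (x - x') = KAop G P (x - x') + V := by
      have h3 : (QAop G P).adjoint (x - x') = opMat G KB (fun k => (P.Q k).transpose) (x - x') :=
        DFunLike.congr_fun (opMat_adjoint G P.Q) _
      rw [hV, opMat_sub, h3]
      exact (add_sub_cancel (KAop G P (x - x')) _).symm
    rw [← map_sub, ← ContinuousLinearMap.adjoint_inner_left, h2, inner_add_left]
  rw [h1, inner_opMat_Umat, PiLp.inner_apply, PiLp.inner_apply, ← Finset.sum_add_distrib,
    Finset.mul_sum, ← Finset.sum_neg_distrib]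
  refine Finset.sum_le_sum fun j _ => ?_
  have h2 : β j * ‖b j‖ ^ 2 ≤ inner ℝ (KAop G P (x - x') j) (b j) := by
    rw [map_sub]
    exact hB j _ _
  have h3 := (abs_le.1 (abs_real_inner_le_norm (V j) (b j))).1
  have hj := hβ j
  have h4 : 0 ≤ β j * (‖b j‖ - 2⁻¹ * (β j)⁻¹ * ‖V j‖) ^ 2 := by positivity
  have h5 : β j * (‖b j‖ - 2⁻¹ * (β j)⁻¹ * ‖V j‖) ^ 2 =
      β j * ‖b j‖ ^ 2 - ‖V j‖ * ‖b j‖ + 4⁻¹ * ((β j)⁻¹ * ‖V j‖ ^ 2) := by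
    field_simp
    ring
  linarith

include hβ hB in
/-- The core operator is monotone, with a quantitative gain in terms of `M_A`. -/
theorem coreOp_monotone (hA : ∀ i, IsMonotoneOp (A i)) {α : ℝ} (hα : α ∈ Set.Ioo (0 : ℝ) 4)
    {x x' v v' : ByOp G KA} (hv : v ∈ coreOp P A B α x) (hv' : v' ∈ coreOp P A B α x') :
    (1 - α / 4) * ‖MA G P (x - x')‖ ^ 2 ≤ inner ℝ (x - x') (v - v') := by
  obtain ⟨w, hw, rfl⟩ := hv
  obtain ⟨w', hw', rfl⟩ := hv'
  have h1 : 0 ≤ inner ℝ (x - x') (w - w') := by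
    rw [PiLp.inner_apply]
    exact Finset.sum_nonneg fun i _ => hA i _ _ _ _ (hw i) (hw' i)
  have h2 := inner_forward_ge (P := P) hβ hB x x'
  have h3 := inner_DA_sub_LA hP (x - x')
  have h4 := inner_opMat_self_nonneg G (fun k => (hP k).Z_ge_U) (x - x')
  have h5 := inner_opMat_self_nonneg G (fun k => (hP k).Z_ge_W) (x - x')
  rw [opMat_sub, inner_sub_right, sub_nonneg] at h4 h5
  rw [norm_MA_sq, ← funext fun k => (hP k).W_eq]
  have h6 : DA G P x - (2 : ℝ) • LA G P x + α • w + α • QAop G P (liftB B (KAop G P x)) -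
      (DA G P x' - (2 : ℝ) • LA G P x' + α • w' + α • QAop G P (liftB B (KAop G P x'))) =
      (DA G P (x - x') - (2 : ℝ) • LA G P (x - x')) + α • (w - w') +
        α • (QAop G P (liftB B (KAop G P x)) - QAop G P (liftB B (KAop G P x'))) := by
    simp only [map_sub, smul_sub]
    abel
  rw [h6, inner_add_right, inner_add_right, real_inner_smul_right, real_inner_smul_right, h3]
  have h7 := mul_nonneg hα.1.le h1
  have h8 := mul_le_mul_of_nonneg_left h2 hα.1.le
  -- `Z` is split as `(α/4) Z + (1 - α/4) Z`: the first share absorbs the loss from `U`, the second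
  -- dominates `W`.
  have h9 := mul_le_mul_of_nonneg_left h4 (show 0 ≤ α / 4 by linarith [hα.1])
  have h10 := mul_le_mul_of_nonneg_left h5 (show 0 ≤ 1 - α / 4 by linarith [hα.2])
  linarith

end CoreOperator

/-! ### Inverting the core operator, its maximality, and the link with solutions. -/

section Solve

variable {p n m : ℕ} {G : Fin p → Type*} [∀ k, NormedAddCommGroup (G k)]
  [∀ k, InnerProductSpace ℝ (G k)] [∀ k, CompleteSpace (G k)]
  {KA : Fin n → Finset (Fin p)} {KB : Fin m → Finset (Fin p)}

/-- The part `-2 L_A + α Q_A 𝐁 K_A` of the core operator. -/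
def forward (P : Params KA KB) (B : ∀ j, OpSpace G KB j → OpSpace G KB j) (α : ℝ)
    (x : ByOp G KA) : ByOp G KA :=
  α • QAop G P (liftB B (KAop G P x)) - (2 : ℝ) • LA G P x

variable (G) in
/-- The `i`-th diagonal block of `D_A + e I`. -/
def diagBlock (P : Params KA KB) (e : ℝ) (i : Fin n) : OpSpace G KA i →L[ℝ] OpSpace G KA i :=
  directSum fun k : {k // k ∈ KA i} => (P.Z k.1 ⟨i, k.2⟩ ⟨i, k.2⟩ + e) • .id ℝ (G k.1)

variable {P : Params KA KB}

omit [∀ k, CompleteSpace (G k)] in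
theorem diagBlock_apply (e : ℝ) (i : Fin n) (x : OpSpace G KA i) (k : {k // k ∈ KA i}) :
    diagBlock G P e i x k = (P.Z k.1 ⟨i, k.2⟩ ⟨i, k.2⟩ + e) • x k := rfl

theorem diagBlock_apply_eq (e : ℝ) (x : ByOp G KA) (i : Fin n) :
    diagBlock G P e i (x i) = DA G P x i + e • x i := by
  ext k
  have h : DA G P x i k = P.Z k.1 ⟨i, k.2⟩ ⟨i, k.2⟩ • x i k :=
    opMat_diagonal_apply G (fun k s => P.Z k s s) x i k
  rw [diagBlock_apply, PiLp.add_apply, PiLp.smul_apply, h, add_smul]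

omit [∀ k, CompleteSpace (G k)] in
theorem exists_diagBlock_coercive (hZ : ∀ k s, 0 < P.Z k s s) {e : ℝ} (he : 0 ≤ e) (i : Fin n) :
    ∃ d, 0 < d ∧ ∀ x, d * ‖x‖ ^ 2 ≤ inner ℝ x (diagBlock G P e i x) := by
  obtain ⟨d, hd, h⟩ : ∃ d, 0 < d ∧ ∀ k : {k // k ∈ KA i}, d ≤ P.Z k.1 ⟨i, k.2⟩ ⟨i, k.2⟩ := by
    rcases isEmpty_or_nonempty {k // k ∈ KA i} with hE | hE
    · exact ⟨1, one_pos, fun k => hE.elim k⟩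
    · obtain ⟨k, hk⟩ := Finite.exists_min fun k : {k // k ∈ KA i} => P.Z k.1 ⟨i, k.2⟩ ⟨i, k.2⟩
      exact ⟨_, hZ _ _, hk⟩
  refine ⟨d, hd, fun x => ?_⟩
  rw [PiLp.norm_sq_eq_of_L2, PiLp.inner_apply, Finset.mul_sum]
  refine Finset.sum_le_sum fun k _ => ?_
  rw [diagBlock_apply, real_inner_smul_right, real_inner_self_eq_norm_sq]
  exact mul_le_mul_of_nonneg_right (by linarith [h k]) (sq_nonneg _)

variable {A : ∀ i, OpSpace G KA i → Set (OpSpace G KA i)}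
  {B : ∀ j, OpSpace G KB j → OpSpace G KB j} {α : ℝ}

/-- The shift `e` serves two purposes: `e = 0` yields `S`, and `e = 1` yields surjectivity of
identity plus core operator, hence maximality. -/
theorem mem_coreOp_iff (e : ℝ) {x v : ByOp G KA} : v - e • x ∈ coreOp P A B α x ↔
    ∃ w : ByOp G KA, ∀ i, w i ∈ A i (x i) ∧
      diagBlock G P e i (x i) + α • w i + forward P B α x i = v i := by
  refine exists_congr fun w => ?_
  rw [forall_and]
  refine and_congr Iff.rfl ?_
  constructor
  · intro h i
    rw [sub_eq_iff_eq_add] at h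
    rw [h, diagBlock_apply_eq, forward]
    simp only [PiLp.add_apply, PiLp.sub_apply, PiLp.smul_apply]
    abel
  · intro h
    ext1 i
    rw [PiLp.sub_apply, ← h i, diagBlock_apply_eq, forward]
    simp only [PiLp.add_apply, PiLp.sub_apply, PiLp.smul_apply]
    abel

/-- `B_j` reads only operators up to `c j` and writes only to later ones. The cutoff has to be
common to all subvectors since `B_j` mixes them, whereas `K_before_Q` compares entries for a single
`k`. -/
theorem Cutoff.strictlyCausal_forward {c : Fin m → Fin n} (hc : Cutoff P c) :
    StrictlyCausal (forward P B α) := by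
  intro x x' i h
  ext k
  have h1 : LA G P x i k = LA G P x' i k := by
    have e : ∀ y, LA G P y i k = ∑ s, (-strictLower (P.Z k.1)) ⟨i, k.2⟩ s • y s.1 ⟨k.1, s.2⟩ :=
      fun y => opMat_apply G _ y i k
    rw [e, e]
    refine Finset.sum_congr rfl fun s _ => ?_
    by_cases hs : s < ⟨i, k.2⟩
    · rw [h s.1 hs]
    · simp [strictLower, hs]
  have h2 : QAop G P (liftB B (KAop G P x)) i k = QAop G P (liftB B (KAop G P x')) i k := by
    have e : ∀ y, QAop G P y i k = ∑ j, P.Q k.1 ⟨i, k.2⟩ j • y j.1 ⟨k.1, j.2⟩ :=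
      fun y => opMat_apply G _ y i k
    rw [e, e]
    refine Finset.sum_congr rfl fun j _ => ?_
    by_cases hQ : P.Q k.1 ⟨i, k.2⟩ j = 0
    · rw [hQ, zero_smul, zero_smul]
    have hK : KAop G P x j.1 = KAop G P x' j.1 := by
      ext k'
      have e' : ∀ y, KAop G P y j.1 k' =
          ∑ s, P.K k'.1 ⟨j.1, k'.2⟩ s • y s.1 ⟨k'.1, s.2⟩ := fun y => opMat_apply G _ y j.1 k'
      rw [e', e']
      refine Finset.sum_congr rfl fun s _ => ?_
      by_cases hK : P.K k'.1 ⟨j.1, k'.2⟩ s = 0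
      · rw [hK, zero_smul, zero_smul]
      · rw [h s.1 ((hc.K_cut _ _ _ hK).trans_lt (hc.Q_cut _ _ _ hQ))]
    have hl : liftB B (KAop G P x) j.1 = liftB B (KAop G P x') j.1 := congrArg (B j.1) hK
    rw [hl]
  simp only [forward, PiLp.sub_apply, PiLp.smul_apply, h1, h2]

theorem exists_forward_lipschitz {β : Fin m → ℝ} (hβ : ∀ j, 0 < β j)
    (hB : ∀ j, IsCocoercive (β j) (B j)) :
    ∃ K, ∀ x x', ‖forward P B α x - forward P B α x'‖ ≤ K * ‖x - x'‖ := by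
  have hL : ∀ y y' : ByOp G KB, ‖liftB B y - liftB B y'‖ ≤ (∑ j, (β j)⁻¹) * ‖y - y'‖ := by
    intro y y'
    have hs : 0 ≤ ∑ j, (β j)⁻¹ := Finset.sum_nonneg fun j _ => (inv_pos.2 (hβ j)).le
    refine le_of_sq_le_sq ?_ (by positivity)
    rw [mul_pow, PiLp.norm_sq_eq_of_L2, PiLp.norm_sq_eq_of_L2, Finset.mul_sum]
    refine Finset.sum_le_sum fun j _ => ?_
    rw [← mul_pow]
    refine pow_le_pow_left₀ (norm_nonneg _) (((hB j).lipschitz (hβ j) _ _).trans ?_) 2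
    exact mul_le_mul_of_nonneg_right (Finset.single_le_sum (f := fun j => (β j)⁻¹)
      (fun j _ => (inv_pos.2 (hβ j)).le) (Finset.mem_univ j)) (norm_nonneg _)
  refine ⟨|α| * (‖QAop G P‖ * ((∑ j, (β j)⁻¹) * ‖KAop G P‖)) + 2 * ‖LA G P‖, fun x x' => ?_⟩
  have e : forward P B α x - forward P B α x' =
      α • QAop G P (liftB B (KAop G P x) - liftB B (KAop G P x')) -
        (2 : ℝ) • LA G P (x - x') := by
    simp only [forward, map_sub, smul_sub]
    abel
  rw [e]
  refine (norm_sub_le _ _).trans ?_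
  rw [norm_smul, norm_smul, Real.norm_eq_abs, Real.norm_two, add_mul]
  refine add_le_add ?_ ?_
  · rw [mul_assoc]
    refine mul_le_mul_of_nonneg_left ?_ (abs_nonneg α)
    refine ((QAop G P).le_opNorm _).trans ?_
    rw [mul_assoc]
    refine mul_le_mul_of_nonneg_left ((hL _ _).trans ?_) (norm_nonneg _)
    rw [mul_assoc, ← map_sub]
    exact mul_le_mul_of_nonneg_left ((KAop G P).le_opNorm _)
      (Finset.sum_nonneg fun j _ => (inv_pos.2 (hβ j)).le)
  · rw [mul_assoc]
    exact mul_le_mul_of_nonneg_left ((LA G P).le_opNorm _) zero_le_two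

theorem exists_mem_coreOp (hZ : ∀ k s, 0 < P.Z k s s) {c : Fin m → Fin n} (hc : Cutoff P c)
    (hA : ∀ i, IsMaximalMonotone (A i)) (hα : 0 < α) {e : ℝ} (he : 0 ≤ e) (v : ByOp G KA) :
    ∃ x, v - e • x ∈ coreOp P A B α x := by
  choose d hd hD using exists_diagBlock_coercive (G := G) hZ he
  obtain ⟨x, h⟩ := hc.strictlyCausal_forward.exists_solution hd hD hα hA v
  exact ⟨x, (mem_coreOp_iff e).2 h⟩

theorem mem_coreOp_iff_zero {x v : ByOp G KA} : v ∈ coreOp P A B α x ↔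
    ∃ w : ByOp G KA, ∀ i, w i ∈ A i (x i) ∧
      diagBlock G P 0 i (x i) + α • w i + forward P B α x i = v i := by
  rw [← mem_coreOp_iff 0, zero_smul, sub_zero]

theorem coreOp_injective (hZ : ∀ k s, 0 < P.Z k s s) {c : Fin m → Fin n} (hc : Cutoff P c)
    (hA : ∀ i, IsMonotoneOp (A i)) (hα : 0 < α) {x x' v : ByOp G KA}
    (h : v ∈ coreOp P A B α x) (h' : v ∈ coreOp P A B α x') : x = x' := by
  choose d hd hD using exists_diagBlock_coercive (G := G) hZ le_rfl
  obtain ⟨w, hw⟩ := mem_coreOp_iff_zero.1 h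
  obtain ⟨w', hw'⟩ := mem_coreOp_iff_zero.1 h'
  exact (hc.strictlyCausal_forward (B := B)).solution_unique hd hD hα hA hw hw'

theorem mem_coreOp_iff_eq_S (hZ : ∀ k s, 0 < P.Z k s s) {c : Fin m → Fin n} (hc : Cutoff P c)
    (hA : ∀ i, IsMaximalMonotone (A i)) (hα : 0 < α) (z : ZSpace G KA) (x : ByOp G KA) :
    -(MA G P).adjoint z ∈ coreOp P A B α x ↔ x = S P A B α z := by
  have hS : -(MA G P).adjoint z ∈ coreOp P A B α (S P A B α z) := by
    obtain ⟨y, hy⟩ := exists_mem_coreOp (B := B) hZ hc hA hα le_rfl (-(MA G P).adjoint z)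
    rw [zero_smul, sub_zero] at hy
    exact Classical.epsilon_spec (p := fun x => -(MA G P).adjoint z ∈ coreOp P A B α x) ⟨y, hy⟩
  refine ⟨fun h => coreOp_injective hZ hc (fun i => (hA i).1) hα h hS, fun h => ?_⟩
  rw [h]
  exact hS

/-- Monotonicity controls only `M_A x`, which ignores consensus vectors; boundedness of `x` itself
comes from the triangular structure. -/
theorem coreOp_bounded (hZ : ∀ k s, 0 < P.Z k s s) {c : Fin m → Fin n} (hc : Cutoff P c)
    (hA : ∀ i, IsMonotoneOp (A i)) (hα : 0 < α) {β : Fin m → ℝ} (hβ : ∀ j, 0 < β j)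
    (hB : ∀ j, IsCocoercive (β j) (B j)) {x v : ℕ → ByOp G KA}
    (h : ∀ ν, v ν ∈ coreOp P A B α (x ν)) {C : ℝ} (hv : ∀ ν, ‖v ν‖ ≤ C) :
    ∃ C', ∀ ν, ‖x ν‖ ≤ C' := by
  choose d hd hD using exists_diagBlock_coercive (G := G) hZ le_rfl
  choose w hw using fun ν => mem_coreOp_iff_zero.1 (h ν)
  obtain ⟨K, hK⟩ := exists_forward_lipschitz (P := P) (α := α) hβ hB
  exact hc.strictlyCausal_forward.exists_bound hd hD hα hA hK hw hv

/-- The core operator contains every pair that is monotonically related to its graph. -/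
theorem mem_coreOp_of_forall (hZ : ∀ k s, 0 < P.Z k s s) {c : Fin m → Fin n} (hc : Cutoff P c)
    (hA : ∀ i, IsMaximalMonotone (A i)) (hα : 0 < α) {x v : ByOp G KA}
    (h : ∀ a, ∀ u ∈ coreOp P A B α a, 0 ≤ inner ℝ (x - a) (v - u)) : v ∈ coreOp P A B α x := by
  -- Surjectivity gives a graph point `(a, v + x - a)`; testing against it yields `0 ≤ -‖x - a‖²`,
  -- so `a = x`.
  obtain ⟨a, ha⟩ := exists_mem_coreOp (B := B) hZ hc hA hα zero_le_one (v + x)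
  rw [one_smul] at ha
  have h1 := h a _ ha
  have h2 : v - (v + x - a) = -(x - a) := by abel
  rw [h2, inner_neg_right, real_inner_self_eq_norm_sq] at h1
  have h3 : x - a = 0 := norm_eq_zero.1 (pow_eq_zero_iff two_ne_zero |>.1 (by nlinarith))
  obtain rfl := sub_eq_zero.1 h3
  rwa [add_sub_cancel_right] at ha

theorem DA_DAinv (hZ : ∀ k s, 0 < P.Z k s s) (x : ByOp G KA) :
    DA G P (DAinv G P x) = x ∧ DAinv G P (DA G P x) = x := by
  have hdet : ∀ k, IsUnit (diagPart (P.Z k)).det := fun k => by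
    rw [diagPart, Matrix.det_diagonal, isUnit_iff_ne_zero]
    exact Finset.prod_ne_zero_iff.2 fun s _ => (hZ k s).ne'
  have h1 := DFunLike.congr_fun (opMat_comp G (fun k => diagPart (P.Z k))
    (fun k => (diagPart (P.Z k))⁻¹)) x
  have h2 := DFunLike.congr_fun (opMat_comp G (fun k => (diagPart (P.Z k))⁻¹)
    (fun k => diagPart (P.Z k))) x
  simp only [fun k => Matrix.mul_nonsing_inv _ (hdet k),
    fun k => Matrix.nonsing_inv_mul _ (hdet k)] at h1 h2
  exact ⟨h1.trans (opMat_one G x), h2.trans (opMat_one G x)⟩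

theorem isStep_iff (hZ : ∀ k s, 0 < P.Z k s s) (z : ZSpace G KA) (x : ByOp G KA) :
    IsStep P A B α z x ↔ -(MA G P).adjoint z ∈ coreOp P A B α x := by
  have hrw : ∀ w : ByOp G KA, x + α • DAinv G P w = DAinv G P (-(MA G P).adjoint z +
      (2 : ℝ) • LA G P x - α • QAop G P (liftB B (KAop G P x))) ↔
      -(MA G P).adjoint z =
        DA G P x - (2 : ℝ) • LA G P x + α • w + α • QAop G P (liftB B (KAop G P x)) := by
    intro w
    constructor
    · intro h
      have h1 := congrArg (DA G P) h
      rw [map_add, map_smul, (DA_DAinv hZ _).1, (DA_DAinv hZ _).1] at h1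
      have h2 : DA G P x - (2 : ℝ) • LA G P x + α • w + α • QAop G P (liftB B (KAop G P x)) =
          (DA G P x + α • w) - (2 : ℝ) • LA G P x + α • QAop G P (liftB B (KAop G P x)) := by abel
      rw [h2, h1]
      abel
    · intro h
      rw [h]
      have h2 : DA G P x - (2 : ℝ) • LA G P x + α • w + α • QAop G P (liftB B (KAop G P x)) +
          (2 : ℝ) • LA G P x - α • QAop G P (liftB B (KAop G P x)) = DA G P x + α • w := by abel
      rw [h2, map_add, map_smul, (DA_DAinv hZ _).2]
  simp only [IsStep, resolvent, coreOp, Set.mem_ofPred_eq, Set.mem_image, exists_exists_and_eq_and,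
    hrw]

/-! ### Solutions and zeros -/

variable {β : Fin m → ℝ}
  (hP : ∀ k, MatrixReqs (fun j : Users KB k => β j.1) (P.Z k) (P.W k) (P.M k) (P.K k) (P.Q k))

include hP

/-- On consensus vectors `R_A^*` annihilates the `D_A - 2 L_A` part; `K 1 = 1` gives `K_A R_A =
R_B`, and `Qᵀ 1 = 1` gives `R_A^* Q_A = R_B^*`. -/
theorem selAll_adjoint_core (w : ByOp G KA) (y : PiLp 2 G) :
    (selAll G KA).adjoint (DA G P (selAll G KA y) - (2 : ℝ) • LA G P (selAll G KA y) + α • w +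
      α • QAop G P (liftB B (KAop G P (selAll G KA y)))) =
      α • (∑ i, (sel G KA i).adjoint (w i) +
        ∑ j, (sel G KB j).adjoint (B j (sel G KB j y))) := by
  have h1 : DA G P (selAll G KA y) - (2 : ℝ) • LA G P (selAll G KA y) =
      opMat G KA (fun k => diagPart (P.Z k) - (2 : ℝ) • (-strictLower (P.Z k)))
        (selAll G KA y) := by
    rw [opMat_sub]
    refine congrArg (DA G P (selAll G KA y) - ·) ?_
    ext i k
    have e : LA G P (selAll G KA y) i k = (-strictLower (P.Z k.1)).mulVec 1 ⟨i, k.2⟩ • y k.1 :=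
      opMat_selAll_apply G _ y i k
    rw [PiLp.smul_apply, PiLp.smul_apply, e, opMat_selAll_apply, Matrix.smul_mulVec, smul_smul,
      Pi.smul_apply, smul_eq_mul]
  have h2 : KAop G P (selAll G KA y) = selAll G KB y := opMat_selAll G (fun k => (hP k).K_one) y
  have h3 : ∀ b, (selAll G KA).adjoint (QAop G P b) = (selAll G KB).adjoint b := fun b => by
    refine ext_inner_right ℝ fun y' => ?_
    rw [ContinuousLinearMap.adjoint_inner_left, ContinuousLinearMap.adjoint_inner_left,
      ← ContinuousLinearMap.adjoint_inner_right]
    have e : (QAop G P).adjoint (selAll G KA y') = selAll G KB y' :=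
      (DFunLike.congr_fun (opMat_adjoint G P.Q) _).trans
        (opMat_selAll G (fun k => (hP k).Q_one) y')
    rw [e]
  have h4 : (selAll G KA).adjoint
      (DA G P (selAll G KA y) - (2 : ℝ) • LA G P (selAll G KA y)) = 0 := by
    rw [h1]
    exact selAll_adjoint_opMat_selAll G (fun k => by convert (hP k).sum_core_mulVec_one) y
  rw [map_add, map_add, map_smul, map_smul, h4, h3, h2,
    selAll_adjoint_eq_sum, selAll_adjoint_eq_sum, zero_add, ← smul_add]
  rfl

theorem exists_mem_coreOp_selAll_of_isSolution [∀ k, Nonempty (Users KA k)] {y : PiLp 2 G}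
    (hy : IsSolution A B y) :
    ∃ z, -(MA G P).adjoint z ∈ coreOp P A B α (selAll G KA y) := by
  obtain ⟨w, hw, h⟩ := hy
  have h1 := selAll_adjoint_core (B := B) (α := α) hP (WithLp.toLp 2 w) y
  rw [show ∑ i, (sel G KA i).adjoint ((WithLp.toLp 2 w : ByOp G KA) i) =
    ∑ i, (sel G KA i).adjoint (w i) from rfl, h, smul_zero] at h1
  obtain ⟨z, hz⟩ := exists_MA_adjoint_eq hP h1
  exact ⟨-z, WithLp.toLp 2 w, hw, by rw [map_neg, neg_neg, hz]⟩

theorem isSolution_of_mem_coreOp_selAll (hα : α ≠ 0) {y : PiLp 2 G} {z : ZSpace G KA}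
    (h : -(MA G P).adjoint z ∈ coreOp P A B α (selAll G KA y)) : IsSolution A B y := by
  obtain ⟨w, hw, e⟩ := h
  refine ⟨w, hw, ?_⟩
  have h1 := selAll_adjoint_core (B := B) (α := α) hP w y
  have h2 : (selAll G KA).adjoint ((MA G P).adjoint z) = 0 := by
    refine ext_inner_right ℝ fun y' => ?_
    rw [ContinuousLinearMap.adjoint_inner_left, ContinuousLinearMap.adjoint_inner_left,
      MA_selAll hP, inner_zero_right, inner_zero_left]
  rw [← e, map_neg, h2, neg_zero] at h1
  exact (smul_eq_zero.1 h1.symm).resolve_left hα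

end Solve

end Cabra

end

theorem mainTheorem1 {p n m : ℕ}
    (G : Fin p → Type*) [∀ k, NormedAddCommGroup (G k)] [∀ k, InnerProductSpace ℝ (G k)]
    [∀ k, CompleteSpace (G k)]
    (KA : Fin n → Finset (Fin p)) (KB : Fin m → Finset (Fin p))
    (hn : ∀ k, 2 ≤ Fintype.card (Cabra.Users KA k))
    (A : ∀ i, Cabra.OpSpace G KA i → Set (Cabra.OpSpace G KA i))
    (hA : ∀ i, Cabra.IsMaximalMonotone (A i))
    (β : Fin m → ℝ) (hβ : ∀ j, 0 < β j)
    (B : ∀ j, Cabra.OpSpace G KB j → Cabra.OpSpace G KB j)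
    (hB : ∀ j, Cabra.IsCocoercive (β j) (B j))
    (P : Cabra.Params KA KB)
    (hP : ∀ k, Cabra.MatrixReqs (fun j : Cabra.Users KB k => β j.1)
      (P.Z k) (P.W k) (P.M k) (P.K k) (P.Q k))
    (c : Fin m → Fin n) (hc : Cabra.Cutoff P c)
    (α : ℝ) (hα : α ∈ Set.Ioo (0 : ℝ) 4) :
    -- the operator `S` is well defined, and is what the resolvent step of the algorithm computes
    (∀ z x, -(Cabra.MA G P).adjoint z ∈ Cabra.coreOp P A B α x ↔ x = Cabra.S P A B α z) ∧
    (∀ z x, Cabra.IsStep P A B α z x ↔ x = Cabra.S P A B α z) ∧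
    -- convergence of the iterates
    ((∃ y, Cabra.IsSolution A B y) →
      ∀ γ : ℕ → ℝ, (∀ ν, γ ν ∈ Set.Ioo (0 : ℝ) (2 - α / 2)) →
      Filter.Tendsto (fun N => ∑ ν ∈ Finset.range N, γ ν * (2 - α / 2 - γ ν))
        Filter.atTop Filter.atTop →
      ∀ (z : ℕ → Cabra.ZSpace G KA) (x : ℕ → Cabra.ByOp G KA),
      (∀ ν, Cabra.IsStep P A B α (z ν) (x ν)) →
      (∀ ν, z (ν + 1) = z ν + γ ν • Cabra.MA G P (x ν)) →
      ∃ zstar : Cabra.ZSpace G KA,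
        (∀ g ∈ Set.Ioo (0 : ℝ) (2 - α / 2), Cabra.T P A B α g zstar = zstar) ∧
        Cabra.WeakTendsto z zstar ∧
        (∃ ystar, Cabra.IsSolution A B ystar ∧
          Cabra.S P A B α zstar = Cabra.selAll G KA ystar) ∧
        Cabra.WeakTendsto x (Cabra.S P A B α zstar)) := by
  have hZ : ∀ k s, 0 < P.Z k s s := fun k s => (hP k).Z_diag_pos (hn k) s
  have hne : ∀ k, Nonempty (Cabra.Users KA k) := fun k =>
    Fintype.card_pos_iff.1 (lt_of_lt_of_le two_pos (hn k))
  have hS := Cabra.mem_coreOp_iff_eq_S (B := B) hZ hc hA hα.1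
  have hstep : ∀ z x, Cabra.IsStep P A B α z x ↔ x = Cabra.S P A B α z := fun z x =>
    (Cabra.isStep_iff hZ z x).trans (hS z x)
  refine ⟨hS, hstep, ?_⟩
  rintro ⟨y, hy⟩ γ hγ hsum z x hx hz
  have hmem : ∀ z, -(Cabra.MA G P).adjoint z ∈ Cabra.coreOp P A B α (Cabra.S P A B α z) :=
    fun z => (hS z _).2 rfl
  have hmono : ∀ {x x' v v' : Cabra.ByOp G KA}, v ∈ Cabra.coreOp P A B α x →
      v' ∈ Cabra.coreOp P A B α x' →
      (1 - α / 4) * ‖Cabra.MA G P (x - x')‖ ^ 2 ≤ inner ℝ (x - x') (v - v') :=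
    Cabra.coreOp_monotone hP hβ hB (fun i => (hA i).1) hα
  have hc0 : 0 < 1 - α / 4 := by linarith [hα.2]
  have h2c : 2 * (1 - α / 4) = 2 - α / 2 := by ring
  -- The sign turns the update into `z - γ F z`, and makes `F` cocoercive because `S` inverts the
  -- core operator at `-M_A^* z`.
  let F : Cabra.ZSpace G KA → Cabra.ZSpace G KA := fun z => -Cabra.MA G P (Cabra.S P A B α z)
  have hF : Cabra.IsCocoercive (1 - α / 4) F := by
    intro z z'
    have h1 := hmono (hmem z) (hmem z')
    have h2 : F z - F z' = -Cabra.MA G P (Cabra.S P A B α z - Cabra.S P A B α z') := by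
      simp only [F, map_sub]
      abel
    have h3 : -(Cabra.MA G P).adjoint z - -(Cabra.MA G P).adjoint z' =
        -(Cabra.MA G P).adjoint (z - z') := by
      rw [map_sub]
      abel
    rw [h3, inner_neg_right, ContinuousLinearMap.adjoint_inner_right] at h1
    rw [h2, norm_neg, inner_neg_right, real_inner_comm]
    exact h1
  have hxS : ∀ ν, x ν = Cabra.S P A B α (z ν) := fun ν => (hstep _ _).1 (hx ν)
  obtain ⟨z₀, hz₀⟩ := Cabra.exists_mem_coreOp_selAll_of_isSolution (A := A) (B := B) (α := α) hP hy
  have hFz₀ : F z₀ = 0 := by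
    have h1 : Cabra.MA G P (Cabra.S P A B α z₀) = 0 := by
      rw [← (hS z₀ _).1 hz₀, Cabra.MA_selAll hP]
    simp only [F, h1, neg_zero]
  obtain ⟨⟨C, hC⟩, hF0, zs, hFzs, hlim⟩ := hF.weakLim_iterate hc0 (γ := γ) (z := z)
    (fun ν => by rw [h2c]; exact hγ ν) (by rw [h2c]; exact hsum)
    (fun ν => by rw [hz ν, hxS ν, smul_neg, sub_neg_eq_add]) ⟨z₀, hFz₀⟩
  have hMzs : Cabra.MA G P (Cabra.S P A B α zs) = 0 := neg_eq_zero.1 hFzs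
  refine ⟨zs, fun g _ => ?_, Cabra.weakTendsto_of_weakLim hlim, ?_, ?_⟩
  · rw [Cabra.T, hMzs, smul_zero, add_zero]
  · obtain ⟨ys, hys⟩ := Cabra.exists_eq_selAll hP hMzs
    refine ⟨ys, Cabra.isSolution_of_mem_coreOp_selAll hP (α := α) hα.1.ne' (z := zs) ?_, hys⟩
    rw [← hys]
    exact hmem zs
  · have hcore : ∀ ν, -(Cabra.MA G P).adjoint (z ν) ∈ Cabra.coreOp P A B α (x ν) := fun ν =>
      (hS _ _).2 (hxS ν)
    obtain ⟨C', hC'⟩ := Cabra.coreOp_bounded hZ hc (fun i => (hA i).1) hα.1 hβ hB hcore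
      (C := ‖(Cabra.MA G P).adjoint‖ * C) fun ν => by
        rw [norm_neg]
        exact ((Cabra.MA G P).adjoint.le_opNorm _).trans
          (mul_le_mul_of_nonneg_left (hC ν) (norm_nonneg _))
    have hMx : Tendsto (fun ν => Cabra.MA G P (x ν)) atTop (𝓝 0) := by
      simpa [F, hxS] using hF0.neg
    refine Cabra.weakTendsto_of_weakLim (Cabra.WeakLim.of_ultrafilter fun g hg => ?_)
    obtain ⟨l, hl⟩ := Cabra.exists_weakLim g (Eventually.of_forall hC')
    have hMl : Cabra.MA G P l = 0 :=
      (hl.map (Cabra.MA G P)).unique (Cabra.weakLim_of_tendsto (hMx.mono_left hg))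
    have hlS : l = Cabra.S P A B α zs := by
      refine (hS zs l).1 (Cabra.mem_coreOp_of_forall hZ hc hA hα.1 fun a u hu => ?_)
      -- Moving `M_A^*` across leaves `⟨M_A x, z⟩` as the only pairing of two varying sequences; it
      -- vanishes in the limit as `M_A x → 0` strongly and `z` is bounded.
      have h1 : ∀ ν, 0 ≤ -inner ℝ (Cabra.MA G P (x ν)) (z ν) +
          inner ℝ (Cabra.MA G P a) (z ν) - (inner ℝ u (x ν) - inner ℝ u a) := fun ν => by
        have h2 := (mul_nonneg hc0.le (sq_nonneg _)).trans (hmono (hcore ν) hu)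
        rw [inner_sub_right, inner_neg_right, ContinuousLinearMap.adjoint_inner_right, map_sub,
          inner_sub_left, real_inner_comm u, inner_sub_right] at h2
        linarith
      have h3 : Tendsto (fun ν => -inner ℝ (Cabra.MA G P (x ν)) (z ν) +
          inner ℝ (Cabra.MA G P a) (z ν) - (inner ℝ u (x ν) - inner ℝ u a)) (g : Filter ℕ)
          (𝓝 (-0 + inner ℝ (Cabra.MA G P a) zs - (inner ℝ u l - inner ℝ u a))) :=
        ((Cabra.tendsto_inner_zero_of_bounded (hMx.mono_left hg) hC).neg.add
          ((hlim _).mono_left hg)).sub ((hl u).sub_const _)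
      have h4 := ge_of_tendsto' h3 h1
      rw [inner_sub_right, inner_neg_right, ContinuousLinearMap.adjoint_inner_right, map_sub, hMl,
        zero_sub, inner_neg_left, real_inner_comm u, inner_sub_right]
      linarith
    rw [← hlS]
    exact hl
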